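/- Let $n,k\ge 1$ and let $\mathbf C^{n}\times\mathbf C^{k}$ have coordinates $z=(z_1,\dots,z_n)$, $w=(w_1,\dots,w_k)$. A quadric of type $(n,k)$ is a real submanifold $$\mathcal Q=\{(z,w)\in\mathbf C^{n}\times\mathbf C^{k} : \operatorname{Im} w_j=\langle z,\bar z\rangle_j,\ j=1,\dots,k\},$$ where $\langle z,\bar z\rangle_1,\dots,\langle z,\bar z\rangle_k$ are Hermitian forms on $\mathbf C^n$; write $\langle z,\bar\zeta\rangle=(\langle z,\bar\zeta\rangle_1,\dots,\langle z,\bar\zeta\rangle_k)$ for the corresponding $\mathbf C^k$-valued sesquilinear form. The quadric is nondegenerate if (1) $\langle e,\bar z\rangle=0$ for all $z\in\mathbf C^n$ implies $e=0$, and (2) the $k$ coordinate Hermitian forms are linearly independent over $\mathbf R$. Let $\operatorname{aut}\mathcal Q$ be the real Lie algebra of germs at the origin of vector fields $X=2\operatorname{Re}\bigl(f(z,w)\,\partial/\partial z+g(z,w)\,\partial/\partial w\bigr)$, with $f,g$ holomorphic near the origin, that are tangent to $\mathcal Q$. Assign the weights $[z_i]=1$, $[w_j]=2$, $[\partial/\partial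 z_i]=-1$, $[\partial/\partial w_j]=-2$, and let $g_m\subset\operatorname{aut}\mathcal Q$ be the subspace of fields that are weighted homogeneous of weight $m$ (the components of $f$ are weighted homogeneous polynomials of weight $m+1$, those of $g$ of weight $m+2$). A nondegenerate quadric $\mathcal Q$ is called exceptional if $g_3\neq 0$. Theorem. (a) There are no exceptional quadrics of type $(3,3)$. (b) There are no exceptional quadrics of type $(n,4)$ with $1\le n\le 3$. -/

import Mathlib

open Filter Topology

namespace CRQuadric

/-- The ambient space `ℂ^n × ℂ^k` with coordinates `(z, w)`. -/
abbrev Ambient (n k : ℕ) : Type := (Fin n → ℂ) × (Fin k → ℂ)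

/-- The data of a quadric `{Im w_j = ⟨z, z̄⟩_j, j = 1, …, k}` of CR dimension `n` and codimension
`k` in `ℂ^n × ℂ^k`: a `k`-tuple of Hermitian matrices of size `n`. -/
structure Quadric (n k : ℕ) where
  H : Fin k → Matrix (Fin n) (Fin n) ℂ
  isHermitian : ∀ j, (H j).IsHermitian

namespace Quadric

variable {n k : ℕ}

/-- The `ℂ^k`-valued Hermitian form, `⟨z, ζ̄⟩_j = (H_j z) · ζ̄`, linear in `z` and antilinear
in `ζ`. -/
def form (Q : Quadric n k) (z ζ : Fin n → ℂ) : Fin k → ℂ :=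
  fun j => ∑ a, (Q.H j).mulVec z a * star (ζ a)

/-- The defining functions `ρ_j(z, w) = Im w_j - ⟨z, z̄⟩_j` of the quadric. -/
def definingFun (Q : Quadric n k) (j : Fin k) (p : Ambient n k) : ℝ :=
  (p.2 j).im - (Q.form p.1 p.1 j).re

/-- The quadric as a real submanifold of `ℂ^n × ℂ^k`. -/
def carrier (Q : Quadric n k) : Set (Ambient n k) :=
  {p | ∀ j, Q.definingFun j p = 0}

/-- The values `⟨z, z̄⟩_j` are real, so taking the real part in `definingFun` loses nothing. -/
theorem form_self_im (Q : Quadric n k) (z : Fin n → ℂ) (j : Fin k) : (Q.form z z j).im = 0 := by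
  rw [← Complex.conj_eq_iff_im]
  simp only [form, Matrix.mulVec, dotProduct, Finset.sum_mul, map_sum, map_mul, starRingEnd_apply,
    star_star]
  rw [Finset.sum_comm]
  refine Finset.sum_congr rfl fun a _ => Finset.sum_congr rfl fun b _ => ?_
  have h := (Q.isHermitian j).apply a b
  rw [h]
  ring

/-- A quadric is nondegenerate if its form has no kernel (`⟨e, z̄⟩ = 0` for all `z` only for
`e = 0`) and its coordinate Hermitian forms are linearly independent over `ℝ`. -/
def Nondegenerate (Q : Quadric n k) : Prop :=
  (∀ e : Fin n → ℂ, (∀ z, Q.form e z = 0) → e = 0) ∧ LinearIndependent ℝ Q.H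

/-- The vector `v` is tangent to the quadric at the point `p` of the quadric:
it is annihilated by the real differentials of all defining functions. A real tangent vector
`2 Re (f ∂/∂z + g ∂/∂w)` is identified with the vector `(f, g)` of `ℂ^n × ℂ^k`. -/
def IsTangentAt (Q : Quadric n k) (p v : Ambient n k) : Prop :=
  ∀ j, fderiv ℝ (Q.definingFun j) p v = 0

/-- The tangency condition written out: it is the equation
`2 Re (i g + 2 ⟨f, z̄⟩) = 0` for `v = (f, g)`. -/
theorem isTangentAt_iff (Q : Quadric n k) (p v : Ambient n k) :
    Q.IsTangentAt p v ↔
      ∀ j, 2 * (Complex.I * v.2 j + 2 * Q.form v.1 p.1 j).re = 0 := by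
  have key : ∀ j, fderiv ℝ (Q.definingFun j) p v = (v.2 j).im - 2 * (Q.form v.1 p.1 j).re := by
    intro j
    have hsymm : (Q.form p.1 v.1 j).re = (Q.form v.1 p.1 j).re := by
      have h : star (Q.form p.1 v.1 j) = Q.form v.1 p.1 j := by
        simp only [form, Matrix.mulVec, dotProduct, Finset.sum_mul, star_sum, star_mul', star_star]
        rw [Finset.sum_comm]
        refine Finset.sum_congr rfl fun a _ => Finset.sum_congr rfl fun b _ => ?_
        rw [(Q.isHermitian j).apply a b]
        ring
      rw [← h]
      rfl
    have hd : DifferentiableAt ℝ (Q.definingFun j) p := by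
      have hre : ∀ q : Ambient n k, Q.definingFun j q =
          Complex.imCLM (q.2 j) -
            Complex.reCLM (∑ a, (∑ b, Q.H j a b * q.1 b) * Complex.conjCLE (q.1 a)) := fun q => rfl
      rw [funext hre]
      fun_prop
    have hline : HasDerivAt (fun t : ℝ => p + t • v) v 0 := by
      simpa using ((hasDerivAt_id (0 : ℝ)).smul_const v).const_add p
    have h1 : HasDerivAt (fun t : ℝ => Q.definingFun j (p + t • v))
        (fderiv ℝ (Q.definingFun j) p v) 0 := by
      have hd' : HasFDerivAt (Q.definingFun j) (fderiv ℝ (Q.definingFun j) p)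
          (p + (0 : ℝ) • v) := by
        simpa using hd.hasFDerivAt
      exact hd'.comp_hasDerivAt (0 : ℝ) hline
    have hexp : ∀ t : ℝ, Q.definingFun j (p + t • v) = Q.definingFun j p +
        t * ((v.2 j).im - 2 * (Q.form v.1 p.1 j).re) - t ^ 2 * (Q.form v.1 v.1 j).re := by
      intro t
      have hf : Q.form (p + t • v).1 (p + t • v).1 j = Q.form p.1 p.1 j +
          (t : ℂ) * Q.form v.1 p.1 j + (t : ℂ) * Q.form p.1 v.1 j +
          ((t ^ 2 : ℝ) : ℂ) * Q.form v.1 v.1 j := by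
        have hm : (Q.H j).mulVec (p + t • v).1 =
            (Q.H j).mulVec p.1 + (t : ℂ) • (Q.H j).mulVec v.1 := by
          rw [← Matrix.mulVec_smul, ← Matrix.mulVec_add]
          congr 1
        simp only [form, hm, Finset.mul_sum, ← Finset.sum_add_distrib]
        refine Finset.sum_congr rfl fun a _ => ?_
        simp
        ring
      simp only [definingFun, hf, Complex.add_re, Complex.re_ofReal_mul, hsymm]
      simp
      ring
    have h2 : HasDerivAt (fun t : ℝ => Q.definingFun j (p + t • v))
        ((v.2 j).im - 2 * (Q.form v.1 p.1 j).re) 0 := by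
      rw [funext hexp]
      have h3 := (((hasDerivAt_id (0 : ℝ)).mul_const
        ((v.2 j).im - 2 * (Q.form v.1 p.1 j).re)).const_add (Q.definingFun j p)).sub
        (((hasDerivAt_id (0 : ℝ)).pow 2).mul_const (Q.form v.1 v.1 j).re)
      simp only [id, one_mul, Nat.cast_ofNat, mul_zero, zero_mul, sub_zero,
        Nat.reduceSub, pow_one, mul_one] at h3
      exact h3
    exact h1.unique h2
  refine forall_congr' fun j => ?_
  rw [key]
  simp only [Complex.add_re, Complex.mul_re, Complex.I_re, Complex.I_im, Complex.re_ofNat,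
    Complex.im_ofNat]
  constructor <;> intro h <;> linarith

/-- The real vector space `aut Q` of germs at the origin of vector fields
`2 Re (f(z, w) ∂/∂z + g(z, w) ∂/∂w)` with `(f, g)` holomorphic near the origin that are tangent to
the quadric at all of its points near the origin. The field is recorded as the germ of
`(f, g)`. -/
def aut (Q : Quadric n k) : Submodule ℝ (Germ (𝓝 (0 : Ambient n k)) (Ambient n k)) where
  carrier := {X | ∃ F : Ambient n k → Ambient n k, AnalyticAt ℂ F 0 ∧
    (∀ᶠ p in 𝓝 (0 : Ambient n k), p ∈ Q.carrier → Q.IsTangentAt p (F p)) ∧ (F : Germ _ _) = X}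
  zero_mem' := ⟨0, analyticAt_const, Eventually.of_forall fun p _ j => by simp, rfl⟩
  add_mem' := by
    rintro _ _ ⟨F, hF, hF', rfl⟩ ⟨G, hG, hG', rfl⟩
    refine ⟨F + G, hF.add hG, ?_, rfl⟩
    filter_upwards [hF', hG'] with p h1 h2 hp j
    simp only [Pi.add_apply, map_add]
    rw [h1 hp j, h2 hp j, add_zero]
  smul_mem' := by
    rintro c _ ⟨F, hF, hF', rfl⟩
    refine ⟨c • F, ?_, ?_, rfl⟩
    · have : c • F = (c : ℂ) • F := by
        funext p
        exact (Complex.coe_smul c (F p)).symm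
      rw [this]
      exact analyticAt_const.smul hF
    · filter_upwards [hF'] with p h1 hp j
      simp only [Pi.smul_apply, map_smul]
      rw [h1 hp j, smul_zero]

end Quadric

/-- The weights of the variables: `[z_i] = 1`, `[w_j] = 2`. -/
def varWeight (n k : ℕ) : Fin n ⊕ Fin k → ℤ :=
  Sum.elim (fun _ => 1) (fun _ => 2)

/-- The vector field on `ℂ^n × ℂ^k` with polynomial coefficients `f` (at `∂/∂z`) and `g`
(at `∂/∂w`). -/
noncomputable def polyField {n k : ℕ} (f : Fin n → MvPolynomial (Fin n ⊕ Fin k) ℂ)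
    (g : Fin k → MvPolynomial (Fin n ⊕ Fin k) ℂ) (p : Ambient n k) : Ambient n k :=
  (fun i => MvPolynomial.eval (Sum.elim p.1 p.2) (f i),
    fun j => MvPolynomial.eval (Sum.elim p.1 p.2) (g j))

namespace Quadric

variable {n k : ℕ}

/-- The graded component `g_m` of `aut Q`: the fields in `aut Q` that are weighted homogeneous of
weight `m`. As `∂/∂z_i` has weight `-1` and `∂/∂w_j` has weight `-2`, this means that the power
series of the coefficients at `∂/∂z_i` contain only monomials of weight `m + 1` and those at
`∂/∂w_j` only monomials of weight `m + 2`; so they are polynomials. -/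
def gradedPart (Q : Quadric n k) (m : ℤ) :
    Submodule ℝ (Germ (𝓝 (0 : Ambient n k)) (Ambient n k)) where
  carrier := {X | X ∈ Q.aut ∧ ∃ f g,
    (∀ i, (f i).IsWeightedHomogeneous (varWeight n k) (m + 1)) ∧
    (∀ j, (g j).IsWeightedHomogeneous (varWeight n k) (m + 2)) ∧
    (polyField f g : Germ _ _) = X}
  zero_mem' := by
    refine ⟨zero_mem _, 0, 0, fun i => MvPolynomial.isWeightedHomogeneous_zero _ _ _,
      fun j => MvPolynomial.isWeightedHomogeneous_zero _ _ _, ?_⟩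
    have : polyField (0 : Fin n → MvPolynomial (Fin n ⊕ Fin k) ℂ) 0 = 0 := by
      funext p
      ext <;> simp [polyField]
    rw [this]
    rfl
  add_mem' := by
    rintro _ _ ⟨hX, f, g, hf, hg, rfl⟩ ⟨hY, f', g', hf', hg', rfl⟩
    refine ⟨add_mem hX hY, f + f', g + g', fun i => (hf i).add (hf' i),
      fun j => (hg j).add (hg' j), ?_⟩
    have : polyField (f + f') (g + g') = polyField f g + polyField f' g' := by
      funext p
      ext <;> simp [polyField]
    rw [this]
    rfl
  smul_mem' := by
    rintro c _ ⟨hX, f, g, hf, hg, rfl⟩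
    refine ⟨Submodule.smul_mem _ c hX, fun i => MvPolynomial.C (c : ℂ) * f i,
      fun j => MvPolynomial.C (c : ℂ) * g j, fun i => ?_, fun j => ?_, ?_⟩
    · simpa using (MvPolynomial.isWeightedHomogeneous_C (varWeight n k) (c : ℂ)).mul (hf i)
    · simpa using (MvPolynomial.isWeightedHomogeneous_C (varWeight n k) (c : ℂ)).mul (hg j)
    · have : polyField (fun i => MvPolynomial.C (c : ℂ) * f i)
          (fun j => MvPolynomial.C (c : ℂ) * g j) = c • polyField f g := by
        funext p
        ext <;> simp [polyField]
      rw [this]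
      rfl

/-- A quadric is exceptional if it is nondegenerate and `g_3 ≠ 0`. -/
def IsExceptional (Q : Quadric n k) : Prop :=
  Q.Nondegenerate ∧ Q.gradedPart 3 ≠ ⊥

end Quadric

end CRQuadric

/-! ### Preliminaries: generic points and dot products. -/

open Matrix
open scoped ComplexOrder

namespace CRQuadric

/-! Complexifying the tangency equation makes `z` and `z̄` independent. A field of weight three is
then encoded by a trilinear form `T`, symmetric in its last two arguments, where `T ξ w w` pairs `ξ`
with the conjugate of `f(0, w̄)`. The equation expresses `g` and `f(z, w) - f(0, w)` through `T` and
forces `T (H_j z) ⟨z, ζ⟩ ⟨z, ζ⟩ = 0` (`exists_trilinear`). Since `T = 0` kills the field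
(`gradedPart_three_eq_bot`), what remains is linear algebra on the complex span `M` of the forms, a
matrix space closed under adjoints.

Let `n = 3`. The vectors `evalVec M z η` fill the annihilator of the kernel of `α ↦ M α z`, so for
`ξ` in the image of this map the quadratic form of `T ξ` vanishes on that annihilator. If the rank
is three at some `z`, the kernel is at most a line because `k ≤ 4`; hence `T ξ p p` is zero or has a
fixed linear factor, and testing at generic points kills the other factor. If the rank is at most
two everywhere, two independent members of `M` cannot have parallel values at all points
(`exists_cross_ne_zero`). This forces `k ≤ 3` (`le_three`), and for `k = 3` a nonzero `T` would
produce exactly such a pair (`eq_zero_of_rank_two`).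

For type (2,4) the forms span all matrices, and solvability of the equation for `f(z, w) - f(0, w)`,
together with the symmetry of `T`, suffices (`eq_zero_of_two`). For type (1,4) four forms cannot be
independent. -/

theorem dense_ne_zero_of_analyticOnNhd {E F : Type*} [NormedAddCommGroup E] [NormedSpace ℂ E]
    [NormedAddCommGroup F] [NormedSpace ℂ F] {f : E → F} (hf : AnalyticOnNhd ℂ f Set.univ)
    {x₀ : E} (h : f x₀ ≠ 0) : Dense {x | f x ≠ 0} := by
  intro x
  by_contra hx
  have h0 : f =ᶠ[𝓝 x] 0 := by
    rw [mem_closure_iff_frequently, not_frequently] at hx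
    filter_upwards [hx] with y hy
    simpa using hy
  exact h (hf.eqOn_zero_of_preconnected_of_eventuallyEq_zero isPreconnected_univ
    (Set.mem_univ x) h0 (Set.mem_univ x₀))

/-- A module is not the union of two proper submodules, here the kernels. -/
theorem LinearMap.eq_zero_or_eq_zero {R V W W' : Type*} [Ring R] [AddCommGroup V] [AddCommGroup W]
    [AddCommGroup W'] [Module R V] [Module R W] [Module R W'] (f : V →ₗ[R] W) (g : V →ₗ[R] W')
    (h : ∀ v, f v = 0 ∨ g v = 0) : f = 0 ∨ g = 0 := by
  by_contra! hc
  obtain ⟨x, hx⟩ := DFunLike.ne_iff.1 hc.1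
  obtain ⟨y, hy⟩ := DFunLike.ne_iff.1 hc.2
  have hgx := (h x).resolve_left hx
  have hfy := (h y).resolve_right hy
  rcases h (x + y) with h' | h' <;> simp_all

theorem eq_zero_or_eq_zero_of_dotProduct_mul {n : Type*} [Fintype n] {a b : n → ℂ}
    (h : ∀ η, (a ⬝ᵥ η) * (b ⬝ᵥ η) = 0) : a = 0 ∨ b = 0 := by
  classical
  rcases LinearMap.eq_zero_or_eq_zero (dotProductBilin ℂ ℂ a) (dotProductBilin ℂ ℂ b)
    (fun v => by simpa using mul_eq_zero.1 (h v)) with h' | h'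
  · exact Or.inl (dotProduct_eq_zero _ fun v => by simpa using DFunLike.congr_fun h' v)
  · exact Or.inr (dotProduct_eq_zero _ fun v => by simpa using DFunLike.congr_fun h' v)

theorem LinearMap.apply_eq_dotProduct {k : Type*} [Fintype k] [DecidableEq k] (g : (k → ℂ) →ₗ[ℂ] ℂ)
    (p : k → ℂ) : g p = (fun l => g (Pi.single l 1)) ⬝ᵥ p := by
  conv_lhs => rw [← Finset.univ_sum_single p]
  rw [map_sum]
  refine Finset.sum_congr rfl fun l _ => ?_
  have : (Pi.single l (p l) : k → ℂ) = p l • Pi.single l 1 := by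
    rw [← Pi.single_smul]; simp
  rw [this, map_smul, smul_eq_mul, mul_comm]

/-! ### Matrix spaces closed under adjoints, and their evaluations. -/

/-- A nondegenerate space of square matrices, closed under the adjoint, parametrized by `ℂ^k`. -/
structure IsNondegenerateStarSpace {n k : ℕ}
    (M : (Fin k → ℂ) →ₗ[ℂ] Matrix (Fin n) (Fin n) ℂ) : Prop where
  injective : ∀ α, M α = 0 → α = 0
  exists_conjTranspose : ∀ α, ∃ β, M β = (M α)ᴴ
  ker_eq_zero : ∀ e, (∀ α, M α *ᵥ e = 0) → e = 0

/-- The point of the dual of a matrix space given by evaluation at `z ⊗ η`. -/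
def evalVec {n k : ℕ} (M : (Fin k → ℂ) →ₗ[ℂ] Matrix (Fin n) (Fin n) ℂ) (z : Fin n → ℂ) :
    (Fin n → ℂ) →ₗ[ℂ] (Fin k → ℂ) where
  toFun η l := (M (Pi.single l 1) *ᵥ z) ⬝ᵥ η
  map_add' x y := by ext; simp [dotProduct_add]
  map_smul' c x := by ext; simp [dotProduct_smul]

section
variable {n k : ℕ} {M : (Fin k → ℂ) →ₗ[ℂ] Matrix (Fin n) (Fin n) ℂ}

theorem dotProduct_evalVec (α : Fin k → ℂ) (z η : Fin n → ℂ) :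
    α ⬝ᵥ evalVec M z η = (M α *ᵥ z) ⬝ᵥ η := by
  conv_rhs => rw [← Finset.univ_sum_single α]
  rw [map_sum, sum_mulVec, sum_dotProduct]
  refine Finset.sum_congr rfl fun l _ => ?_
  have : (Pi.single l (α l) : Fin k → ℂ) = α l • Pi.single l 1 := by
    rw [← Pi.single_smul]; simp
  rw [this, map_smul, smul_mulVec, smul_dotProduct]
  rfl

theorem evalVec_zero_left (η : Fin n → ℂ) : evalVec M 0 η = 0 := by
  ext l; simp [evalVec]

/-- Taking adjoints turns the absence of a common kernel into the statement that the images together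
span the space. -/
theorem IsNondegenerateStarSpace.eq_zero_of_dotProduct (hM : IsNondegenerateStarSpace M)
    {w : Fin n → ℂ} (h : ∀ α z, w ⬝ᵥ (M α *ᵥ z) = 0) : w = 0 := by
  rw [← star_eq_zero]
  refine hM.ker_eq_zero _ fun β => ?_
  obtain ⟨α, hα⟩ := hM.exists_conjTranspose β
  have h1 : w ᵥ* M α = 0 := dotProduct_eq_zero _ fun z => by rw [← dotProduct_mulVec, h]
  have h2 := congrArg star h1
  rw [star_vecMul, hα, conjTranspose_conjTranspose] at h2
  simpa using h2

/-- The evaluations at `z ⊗ η` span the dual of the matrix space. -/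
theorem IsNondegenerateStarSpace.eq_zero_of_evalVec (hM : IsNondegenerateStarSpace M)
    {W : Type*} [AddCommGroup W] [Module ℂ W] (φ : (Fin k → ℂ) →ₗ[ℂ] W)
    (h : ∀ z η, φ (evalVec M z η) = 0) : φ = 0 := by
  by_contra hφ
  have hlt : LinearMap.ker φ < ⊤ := lt_top_iff_ne_top.2 (by rwa [Ne, LinearMap.ker_eq_top])
  obtain ⟨g, hg0, hg⟩ := Submodule.exists_le_ker_of_lt_top _ hlt
  have hgα := LinearMap.apply_eq_dotProduct g
  have : (fun l => g (Pi.single l 1)) = 0 := by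
    apply hM.injective
    ext i j
    have := hg (show evalVec M (Pi.single j 1) (Pi.single i 1) ∈ _ from h _ _)
    rw [LinearMap.mem_ker, hgα, dotProduct_evalVec] at this
    simpa using this
  apply hg0
  ext l
  simpa using congrFun this l

/-- The evaluations at a point fill the annihilator of the matrices that vanish at that point. -/
theorem exists_evalVec_eq {z : Fin n → ℂ} {ν : Fin k → ℂ}
    (hν : ∀ α, M α *ᵥ z = 0 → ∃ c : ℂ, c • ν = α) {p : Fin k → ℂ} (hp : ν ⬝ᵥ p = 0) :
    ∃ η, evalVec M z η = p := by
  by_contra hne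
  have hp' : p ∉ LinearMap.range (evalVec M z) := fun h => hne h
  obtain ⟨g, hg0, hg⟩ := Submodule.exists_le_ker_of_notMem hp'
  have hgα := LinearMap.apply_eq_dotProduct g
  obtain ⟨c, hc⟩ := hν (fun l => g (Pi.single l 1)) <| dotProduct_eq_zero _ fun η => by
    rw [← dotProduct_evalVec, ← hgα]
    exact hg ⟨η, rfl⟩
  apply hg0
  rw [hgα, ← hc, smul_dotProduct, hp, smul_zero]

end

/-! ### Cross products and pencils of 3 × 3 matrices. -/

theorem exists_eq_smul_of_cross_eq_zero {a b : Fin 3 → ℂ} (ha : a ≠ 0) (h : a ⨯₃ b = 0) :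
    ∃ c : ℂ, b = c • a := by
  by_contra! hc
  refine crossProduct_ne_zero_iff_linearIndependent.2 ?_ h
  rw [LinearIndependent.pair_iff' ha]
  exact fun c hc' => hc c hc'.symm

theorem exists_eq_add_smul_of_triple_product {a b v : Fin 3 → ℂ} (hab : a ⨯₃ b ≠ 0)
    (hv : v ⬝ᵥ a ⨯₃ b = 0) : ∃ s t : ℂ, v = s • a + t • b := by
  obtain ⟨i, hi⟩ := Function.ne_iff.1 hab
  -- Cramer's rule for `v` in the basis `a`, `b` and the `i`-th unit vector, whose determinant is
  -- the nonzero coordinate.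
  have key : (a ⨯₃ b) i • v = (v ⨯₃ b) i • a + (a ⨯₃ v) i • b + (v ⬝ᵥ a ⨯₃ b) • Pi.single i 1 := by
    ext j
    fin_cases i <;> fin_cases j <;>
      simp [cross_apply, dotProduct, Fin.sum_univ_three] <;> ring
  rw [hv, zero_smul, add_zero] at key
  refine ⟨((a ⨯₃ b) i)⁻¹ * (v ⨯₃ b) i, ((a ⨯₃ b) i)⁻¹ * (a ⨯₃ v) i, ?_⟩
  rw [mul_smul, mul_smul, ← smul_add, ← key, smul_smul, inv_mul_cancel₀ hi, one_smul]

theorem eq_vecMulVec_of_cross_mulVec {A : Matrix (Fin 3) (Fin 3) ℂ} {ξ : Fin 3 → ℂ} (hξ : ξ ≠ 0)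
    (h : ∀ z, ξ ⨯₃ (A *ᵥ z) = 0) : ∃ a, A = vecMulVec ξ a := by
  choose a ha using fun z => exists_eq_smul_of_cross_eq_zero hξ (h z)
  refine ⟨fun j => a (Pi.single j 1), ?_⟩
  ext i j
  have := congrFun (ha (Pi.single j 1)) i
  simpa [vecMulVec_apply, mul_comm] using this

section
variable {k : ℕ} {M : (Fin k → ℂ) →ₗ[ℂ] Matrix (Fin 3) (Fin 3) ℂ}

theorem analyticOnNhd_mulVec (A : Matrix (Fin 3) (Fin 3) ℂ) :
    AnalyticOnNhd ℂ (fun z => A *ᵥ z) Set.univ := by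
  intro z _
  exact ((Matrix.mulVecLin A).toContinuousLinearMap).analyticAt z

theorem analyticOnNhd_cross_mulVec (A B : Matrix (Fin 3) (Fin 3) ℂ) :
    AnalyticOnNhd ℂ (fun z => (A *ᵥ z) ⨯₃ (B *ᵥ z)) Set.univ := by
  intro z hz
  have hA := fun i => analyticAt_pi_iff.1 (analyticOnNhd_mulVec A z hz) i
  have hB := fun i => analyticAt_pi_iff.1 (analyticOnNhd_mulVec B z hz) i
  rw [analyticAt_pi_iff]
  intro i
  fin_cases i <;> simp only [cross_apply]
  · exact ((hA 1).mul (hB 2)).sub ((hA 2).mul (hB 1))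
  · exact ((hA 2).mul (hB 0)).sub ((hA 0).mul (hB 2))
  · exact ((hA 0).mul (hB 1)).sub ((hA 1).mul (hB 0))

theorem dense_cross_mulVec_ne_zero {A B : Matrix (Fin 3) (Fin 3) ℂ} {z : Fin 3 → ℂ}
    (h : (A *ᵥ z) ⨯₃ (B *ᵥ z) ≠ 0) : Dense {z | (A *ᵥ z) ⨯₃ (B *ᵥ z) ≠ 0} :=
  dense_ne_zero_of_analyticOnNhd (analyticOnNhd_cross_mulVec A B) h

theorem continuous_cross_mulVec (A B : Matrix (Fin 3) (Fin 3) ℂ) :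
    Continuous fun z => (A *ᵥ z) ⨯₃ (B *ᵥ z) :=
  continuousOn_univ.1 (analyticOnNhd_cross_mulVec A B).continuousOn

/-- A matrix space whose evaluations have rank at most two contains no pencil whose evaluations
have rank at most one. -/
theorem IsNondegenerateStarSpace.exists_cross_ne_zero (hM : IsNondegenerateStarSpace M)
    (hdet : ∀ α β γ z, (M α *ᵥ z) ⬝ᵥ (M β *ᵥ z) ⨯₃ (M γ *ᵥ z) = 0) {γ₁ γ₂ : Fin k → ℂ}
    (h₁ : γ₁ ≠ 0) (h₂ : ∀ c : ℂ, γ₂ ≠ c • γ₁) :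
    ∃ z, (M γ₁ *ᵥ z) ⨯₃ (M γ₂ *ᵥ z) ≠ 0 := by
  by_contra! hcross
  obtain ⟨z₀, hz₀⟩ : ∃ z₀, M γ₁ *ᵥ z₀ ≠ 0 := by
    by_contra! h
    exact h₁ (hM.injective _ (Matrix.mulVec_injective (funext fun z => by simp [h z])))
  obtain ⟨c, hc⟩ := exists_eq_smul_of_cross_eq_zero hz₀ (hcross z₀)
  set H := M γ₁ with hH
  set G := M (γ₂ - c • γ₁) with hG
  set ξ := H *ᵥ z₀ with hξ
  have hGz : ∀ z, G *ᵥ z = M γ₂ *ᵥ z - c • (H *ᵥ z) := fun z => by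
    rw [hG, map_sub, map_smul, sub_mulVec, smul_mulVec]
  have hG0 : G *ᵥ z₀ = 0 := by rw [hGz, hc, sub_self]
  have hHG : ∀ z, (H *ᵥ z) ⨯₃ (G *ᵥ z) = 0 := fun z => by
    rw [hGz, map_sub, map_smul, hcross, cross_self, smul_zero, sub_zero]
  -- Polarise at `z₀ + y`: as `G` kills `z₀`, only the mixed term survives.
  have hξG : ∀ y, ξ ⨯₃ (G *ᵥ y) = 0 := fun y => by
    have := hHG (z₀ + y)
    simpa [mulVec_add, hG0, hHG y] using this
  obtain ⟨y₁, hy₁⟩ : ∃ y, G *ᵥ y ≠ 0 := by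
    by_contra! h
    exact h₂ c (sub_eq_zero.1
      (hM.injective _ (Matrix.mulVec_injective (funext fun z => by simp [← hG, h z]))))
  have hne : ∀ y, G *ᵥ y ≠ 0 → ξ ⨯₃ (H *ᵥ y) = 0 := by
    intro y hy
    obtain ⟨a, ha⟩ := exists_eq_smul_of_cross_eq_zero hz₀ (hξG y)
    have ha0 : a ≠ 0 := by rintro rfl; exact hy (by simpa using ha)
    have := hHG y
    rw [ha, map_smul, smul_eq_zero_iff_right ha0] at this
    rw [← cross_anticomm, this, neg_zero]
  -- Where `G y = 0`, shifting by `y₁` leads back to a point with `G ≠ 0`. So `H` and `G` both have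
  -- rank one, with image on the line of `ξ`.
  have hξH : ∀ y, ξ ⨯₃ (H *ᵥ y) = 0 := by
    intro y
    by_cases hy : G *ᵥ y = 0
    · have := hne (y + y₁) (by rwa [mulVec_add, hy, zero_add])
      rwa [mulVec_add, map_add, hne y₁ hy₁, add_zero] at this
    · exact hne y hy
  obtain ⟨a, ha⟩ := eq_vecMulVec_of_cross_mulVec hz₀ hξH
  obtain ⟨b, hb⟩ := eq_vecMulVec_of_cross_mulVec hz₀ hξG
  have ha0 : a ≠ 0 := by rintro rfl; exact hz₀ (by rw [hξ, ha]; simp)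
  have hab : star a ⨯₃ star b ≠ 0 := by
    intro h
    obtain ⟨t, ht⟩ := exists_eq_smul_of_cross_eq_zero (star_ne_zero.2 ha0) h
    have ht' : b = star t • a := by rw [← star_star b, ht, star_smul, star_star]
    have h0 : γ₂ - c • γ₁ - star t • γ₁ = 0 := by
      apply hM.injective
      rw [map_sub, map_smul, ← hG, ← hH, hb, ha, ht', vecMulVec_smul, sub_self]
    exact h₂ (c + star t) (by rw [add_smul]; linear_combination (exp := 1) h0)
  obtain ⟨δ₁, hδ₁⟩ := hM.exists_conjTranspose γ₁
  obtain ⟨δ₂, hδ₂⟩ := hM.exists_conjTranspose (γ₂ - c • γ₁)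
  rw [← hH, ha, conjTranspose_vecMulVec] at hδ₁
  rw [← hG, hb, conjTranspose_vecMulVec] at hδ₂
  -- The adjoints take values on the distinct lines of `star a` and `star b`, both nonzero at such
  -- `y`, so the rank bound puts every `M γ y` in their plane.
  have hw : ∀ γ y, star ξ ⬝ᵥ y ≠ 0 → (star a ⨯₃ star b) ⬝ᵥ (M γ *ᵥ y) = 0 := by
    intro γ y hy
    have := hdet γ δ₁ δ₂ y
    rw [hδ₁, hδ₂, vecMulVec_mulVec, vecMulVec_mulVec] at this
    rw [dotProduct_comm]
    simpa [hy] using this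
  refine hab (hM.eq_zero_of_dotProduct fun γ y => ?_)
  by_cases hy : star ξ ⬝ᵥ y = 0
  · have hξξ : star ξ ⬝ᵥ ξ ≠ 0 := by
      rwa [Ne, dotProduct_star_self_eq_zero]
    have := hw γ (y + ξ) (by rwa [dotProduct_add, hy, zero_add])
    rwa [mulVec_add, dotProduct_add, hw γ ξ hξξ, add_zero] at this
  · exact hw γ y hy
end

/-! ### Trilinear forms vanishing on evaluations. -/

section
variable {n k : ℕ} {M : (Fin k → ℂ) →ₗ[ℂ] Matrix (Fin n) (Fin n) ℂ}
  {T : (Fin n → ℂ) →ₗ[ℂ] (Fin k → ℂ) →ₗ[ℂ] (Fin k → ℂ) →ₗ[ℂ] ℂ}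

/-- The linear map `α ↦ M α z`. -/
def applyAt (M : (Fin k → ℂ) →ₗ[ℂ] Matrix (Fin n) (Fin n) ℂ) (z : Fin n → ℂ) :
    (Fin k → ℂ) →ₗ[ℂ] (Fin n → ℂ) where
  toFun α := M α *ᵥ z
  map_add' x y := by simp [add_mulVec]
  map_smul' c x := by simp [smul_mulVec]

@[simp] theorem applyAt_apply (z : Fin n → ℂ) (α : Fin k → ℂ) : applyAt M z α = M α *ᵥ z := rfl

theorem eq_zero_of_diagonal (hsymm : ∀ ξ p q, T ξ p q = T ξ q p) {ξ : Fin n → ℂ}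
    (h : ∀ p, T ξ p p = 0) : T ξ = 0 := by
  ext p q
  have h1 := h (Pi.single p 1 + Pi.single q 1)
  simp only [map_add, LinearMap.add_apply, h, hsymm ξ (Pi.single q 1) (Pi.single p 1)] at h1
  simp only [LinearMap.comp_apply, LinearMap.zero_apply]
  change T ξ (Pi.single p 1) (Pi.single q 1) = 0
  linear_combination h1 / 2

/-- Quadratic forms that vanish on a hyperplane are divisible by its equation. -/
theorem exists_factor (hsymm : ∀ ξ p q, T ξ p q = T ξ q p) {ν : Fin k → ℂ} (hν : ν ≠ 0) :
    ∃ Ψ : (Fin n → ℂ) →ₗ[ℂ] (Fin k → ℂ), ∀ ξ, (∀ p, ν ⬝ᵥ p = 0 → T ξ p p = 0) →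
      ∀ p, T ξ p p = (ν ⬝ᵥ p) * (Ψ ξ ⬝ᵥ p) := by
  obtain ⟨p₁, hp₁⟩ : ∃ p₁, ν ⬝ᵥ p₁ = 1 := by
    refine ⟨(ν ⬝ᵥ star ν)⁻¹ • star ν, ?_⟩
    rw [dotProduct_smul, smul_eq_mul, inv_mul_cancel₀]
    rwa [Ne, dotProduct_self_star_eq_zero]
  -- The factor comes from expanding `T ξ` on the diagonal at `p - (ν ⬝ᵥ p) • p₁`, which lies in the
  -- hyperplane. The formula is linear in `ξ` whether or not `T ξ` vanishes there.
  refine ⟨{ toFun := fun ξ l => 2 * T ξ (Pi.single l 1) p₁ - ν l * T ξ p₁ p₁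
            map_add' := fun x y => by ext l; simp; ring
            map_smul' := fun c x => by ext l; simp; ring }, fun ξ hξ p => ?_⟩
  have hΨ : (fun l => 2 * T ξ (Pi.single l 1) p₁ - ν l * T ξ p₁ p₁) ⬝ᵥ p =
      2 * T ξ p p₁ - (ν ⬝ᵥ p) * T ξ p₁ p₁ := by
    have := LinearMap.apply_eq_dotProduct ((T ξ).flip p₁) p
    rw [LinearMap.flip_apply] at this
    rw [this]
    simp only [dotProduct, LinearMap.flip_apply, Finset.mul_sum, Finset.sum_mul,
      ← Finset.sum_sub_distrib]
    exact Finset.sum_congr rfl fun l _ => by ring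
  have h0 := hξ (p - (ν ⬝ᵥ p) • p₁) (by
    rw [dotProduct_sub, dotProduct_smul, hp₁, smul_eq_mul, mul_one, sub_self])
  simp only [map_sub, map_smul, LinearMap.sub_apply, LinearMap.smul_apply, smul_eq_mul,
    hsymm ξ p₁ p] at h0
  change _ = _ * ((fun l => 2 * T ξ (Pi.single l 1) p₁ - ν l * T ξ p₁ p₁) ⬝ᵥ p)
  rw [hΨ]
  linear_combination h0

/-- The restriction of the cubic `T` to a point, on the annihilator of the matrices vanishing at
that point. -/
theorem apply_self_eq_zero_of_dotProduct {z : Fin n → ℂ}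
    (hT : ∀ α η, T (M α *ᵥ z) (evalVec M z η) (evalVec M z η) = 0) {ν : Fin k → ℂ}
    (hν : ∀ α, M α *ᵥ z = 0 → ∃ c : ℂ, c • ν = α) (α p : Fin k → ℂ) (hp : ν ⬝ᵥ p = 0) :
    T (M α *ᵥ z) p p = 0 := by
  obtain ⟨η, rfl⟩ := exists_evalVec_eq hν hp
  exact hT α η

theorem mulVec_eq_zero_of_dense {A : Matrix (Fin n) (Fin n) ℂ} {s : Set (Fin n → ℂ)} (hs : Dense s)
    (h : ∀ z ∈ s, A *ᵥ z = 0) (z : Fin n → ℂ) : A *ᵥ z = 0 := by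
  have hc : Continuous fun z : Fin n → ℂ => A *ᵥ z := by fun_prop
  exact congrFun (hc.ext_on hs continuous_const h) z

theorem IsNondegenerateStarSpace.eq_zero_of_mulVec (hM : IsNondegenerateStarSpace M)
    {α : Fin k → ℂ} (h : ∀ z, M α *ᵥ z = 0) : α = 0 :=
  hM.injective _ (Matrix.mulVec_injective (funext fun z => by simp [h z]))

theorem exists_ker_generator {z : Fin n → ℂ}
    (h : Module.finrank ℂ (LinearMap.ker (applyAt M z)) = 1) :
    ∃ ν, ν ≠ 0 ∧ M ν *ᵥ z = 0 ∧ ∀ α, M α *ᵥ z = 0 → ∃ c : ℂ, c • ν = α := by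
  obtain ⟨ν, hν, h'⟩ := finrank_eq_one_iff'.1 h
  refine ⟨ν, by simpa using hν, ν.2, fun α hα => ?_⟩
  obtain ⟨c, hc⟩ := h' ⟨α, hα⟩
  exact ⟨c, congrArg Subtype.val hc⟩

end

/-! ### The case n = 3. -/

section
variable {k : ℕ} {M : (Fin k → ℂ) →ₗ[ℂ] Matrix (Fin 3) (Fin 3) ℂ}
  {T : (Fin 3 → ℂ) →ₗ[ℂ] (Fin k → ℂ) →ₗ[ℂ] (Fin k → ℂ) →ₗ[ℂ] ℂ}

theorem exists_eq_of_triple_product_ne_zero {a b c : Fin 3 → ℂ} (h : c ⬝ᵥ a ⨯₃ b ≠ 0)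
    (v : Fin 3 → ℂ) : ∃ r s t : ℂ, v = r • a + s • b + t • c := by
  have hab : a ⨯₃ b ≠ 0 := by rintro h'; simp [h'] at h
  obtain ⟨r, s, hrs⟩ := exists_eq_add_smul_of_triple_product (v := v - ((v ⬝ᵥ a ⨯₃ b) / (c ⬝ᵥ a ⨯₃ b)) • c)
    hab (by rw [sub_dotProduct, smul_dotProduct, smul_eq_mul, div_mul_cancel₀ _ h, sub_self])
  exact ⟨r, s, _, by rw [← hrs, sub_add_cancel]⟩

theorem analyticOnNhd_triple_product (A B C : Matrix (Fin 3) (Fin 3) ℂ) :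
    AnalyticOnNhd ℂ (fun z => (A *ᵥ z) ⬝ᵥ (B *ᵥ z) ⨯₃ (C *ᵥ z)) Set.univ := by
  intro z hz
  have hA := fun i => analyticAt_pi_iff.1 (analyticOnNhd_mulVec A z hz) i
  have hB := fun i => analyticAt_pi_iff.1 (analyticOnNhd_cross_mulVec B C z hz) i
  exact Finset.analyticAt_fun_sum _ fun i _ => (hA i).mul (hB i)

theorem surjective_applyAt {α β γ : Fin k → ℂ} {z : Fin 3 → ℂ}
    (h : (M α *ᵥ z) ⬝ᵥ (M β *ᵥ z) ⨯₃ (M γ *ᵥ z) ≠ 0) : Function.Surjective (applyAt M z) := by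
  intro v
  obtain ⟨r, s, t, rfl⟩ := exists_eq_of_triple_product_ne_zero h v
  exact ⟨r • β + s • γ + t • α, by simp [add_mulVec, smul_mulVec]⟩

/-- If the evaluations of `M` have rank three at some point and `k ≤ 4`, then `T = 0`. -/
theorem IsNondegenerateStarSpace.eq_zero_of_triple_product_ne_zero
    (hM : IsNondegenerateStarSpace M) (hsymm : ∀ ξ p q, T ξ p q = T ξ q p)
    (hT : ∀ α z η, T (M α *ᵥ z) (evalVec M z η) (evalVec M z η) = 0) (hk : k ≤ 4)
    {α β γ : Fin k → ℂ} {z : Fin 3 → ℂ}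
    (h : (M α *ᵥ z) ⬝ᵥ (M β *ᵥ z) ⨯₃ (M γ *ᵥ z) ≠ 0) : T = 0 := by
  have hsurj := surjective_applyAt h
  have hrank := LinearMap.finrank_range_add_finrank_ker (applyAt M z)
  rw [LinearMap.range_eq_top.2 hsurj, finrank_top, Module.finrank_fin_fun, Module.finrank_fin_fun]
    at hrank
  refine LinearMap.ext fun ξ => eq_zero_of_diagonal hsymm fun p => ?_
  obtain h0 | h1 : Module.finrank ℂ (LinearMap.ker (applyAt M z)) = 0 ∨
      Module.finrank ℂ (LinearMap.ker (applyAt M z)) = 1 := by omega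
  · obtain ⟨δ, rfl⟩ := hsurj ξ
    refine apply_self_eq_zero_of_dotProduct (hT · z) (ν := 0) (fun α hα => ⟨0, ?_⟩) δ p (by simp)
    rw [Submodule.finrank_eq_zero, LinearMap.ker_eq_bot'] at h0
    rw [h0 α hα, smul_zero]
  · obtain ⟨ν, hν0, -, hν⟩ := exists_ker_generator h1
    obtain ⟨Ψ, hΨ⟩ := exists_factor hsymm hν0
    have hfac : ∀ ξ p, T ξ p p = (ν ⬝ᵥ p) * (Ψ ξ ⬝ᵥ p) := fun ξ => hΨ ξ fun p hp => by
      obtain ⟨δ, rfl⟩ := hsurj ξ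
      exact apply_self_eq_zero_of_dotProduct (hT · z) hν δ p hp
    obtain ⟨y, hy⟩ : ∃ y, M ν *ᵥ y ≠ 0 := by
      by_contra! h'
      exact hν0 (hM.eq_zero_of_mulVec h')
    have hd1 := dense_ne_zero_of_analyticOnNhd (analyticOnNhd_triple_product _ _ _) h
    have hd2 := dense_ne_zero_of_analyticOnNhd (analyticOnNhd_mulVec _) hy
    have ho2 : IsOpen {z | M ν *ᵥ z ≠ 0} := isOpen_ne_fun (by fun_prop) continuous_const
    -- At a generic `x` the two factors, taken at `evalVec M x η`, are the pairings of `M ν x` and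
    -- `M (Ψ ξ) x` with `η`. Their product vanishes for all `η`, while `M ν x ≠ 0`.
    have hΨ0 : Ψ ξ = 0 := hM.eq_zero_of_mulVec <|
      mulVec_eq_zero_of_dense (hd1.inter_of_isOpen_right hd2 ho2) fun x ⟨hx1, hx2⟩ => by
        refine (eq_zero_or_eq_zero_of_dotProduct_mul fun η => ?_).resolve_left hx2
        obtain ⟨δ, hδ⟩ := surjective_applyAt hx1 ξ
        rw [← dotProduct_evalVec, ← dotProduct_evalVec, ← hfac, ← hδ]
        exact hT δ x η
    rw [hfac, hΨ0, zero_dotProduct, mul_zero]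

/-- Expand the determinant at `z + t y`. The constant term is absent because `M γ z = 0`, and the
`t³` term is the determinant at `y`; `t = ±1` separates the other two. The first identity says that
`M γ y` stays in the plane of values at `z`, if that is a plane. -/
theorem triple_product_polar (hdet : ∀ α β γ z, (M α *ᵥ z) ⬝ᵥ (M β *ᵥ z) ⨯₃ (M γ *ᵥ z) = 0)
    {γ : Fin k → ℂ} {z : Fin 3 → ℂ} (hγ : M γ *ᵥ z = 0) (α β : Fin k → ℂ) (y : Fin 3 → ℂ) :
    (M γ *ᵥ y) ⬝ᵥ (M α *ᵥ z) ⨯₃ (M β *ᵥ z) = 0 ∧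
    (M γ *ᵥ y) ⬝ᵥ (M α *ᵥ y) ⨯₃ (M β *ᵥ z) + (M γ *ᵥ y) ⬝ᵥ (M α *ᵥ z) ⨯₃ (M β *ᵥ y) = 0 := by
  have h := hdet γ α β
  have e : ∀ t : ℂ, t * ((M γ *ᵥ y) ⬝ᵥ (M α *ᵥ z) ⨯₃ (M β *ᵥ z)) +
      t ^ 2 * ((M γ *ᵥ y) ⬝ᵥ (M α *ᵥ y) ⨯₃ (M β *ᵥ z) + (M γ *ᵥ y) ⬝ᵥ (M α *ᵥ z) ⨯₃ (M β *ᵥ y)) +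
      t ^ 3 * ((M γ *ᵥ y) ⬝ᵥ (M α *ᵥ y) ⨯₃ (M β *ᵥ y)) = 0 := by
    intro t
    have := h (z + t • y)
    simp only [mulVec_add, mulVec_smul, hγ, zero_add, map_add, map_smul, LinearMap.add_apply,
      LinearMap.smul_apply, smul_dotProduct, dotProduct_add, dotProduct_smul, smul_eq_mul] at this
    linear_combination this
  have h1 := e 1
  have h2 := e (-1)
  rw [h y] at h1 h2
  constructor
  · linear_combination (h1 - h2) / 2
  · linear_combination (h1 + h2) / 2

theorem finrank_range_applyAt
    (hdet : ∀ α β γ z, (M α *ᵥ z) ⬝ᵥ (M β *ᵥ z) ⨯₃ (M γ *ᵥ z) = 0) {α β : Fin k → ℂ}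
    {z : Fin 3 → ℂ} (h : (M α *ᵥ z) ⨯₃ (M β *ᵥ z) ≠ 0) :
    Module.finrank ℂ (LinearMap.range (applyAt M z)) = 2 := by
  have hli := crossProduct_ne_zero_iff_linearIndependent.1 h
  have : LinearMap.range (applyAt M z) = Submodule.span ℂ (Set.range ![M α *ᵥ z, M β *ᵥ z]) := by
    apply le_antisymm
    · rintro _ ⟨γ, rfl⟩
      obtain ⟨s, t, hst⟩ := exists_eq_add_smul_of_triple_product h (hdet γ α β z)
      rw [Matrix.range_cons_cons_empty]
      exact Submodule.mem_span_pair.2 ⟨s, t, hst.symm⟩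
    · rw [Submodule.span_le]
      rintro _ ⟨i, rfl⟩
      fin_cases i
      · exact ⟨α, rfl⟩
      · exact ⟨β, rfl⟩
  rw [this, finrank_span_eq_card hli, Fintype.card_fin]

/-- If the evaluations of `M` have rank at most two, then `k ≤ 3`. -/
theorem IsNondegenerateStarSpace.le_three (hM : IsNondegenerateStarSpace M)
    (hdet : ∀ α β γ z, (M α *ᵥ z) ⬝ᵥ (M β *ᵥ z) ⨯₃ (M γ *ᵥ z) = 0) {α β : Fin k → ℂ}
    {z : Fin 3 → ℂ} (h : (M α *ᵥ z) ⨯₃ (M β *ᵥ z) ≠ 0) : k ≤ 3 := by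
  by_contra! hk
  have hrank := LinearMap.finrank_range_add_finrank_ker (applyAt M z)
  rw [finrank_range_applyAt hdet h, Module.finrank_fin_fun] at hrank
  have : Nontrivial (LinearMap.ker (applyAt M z)) :=
    Module.nontrivial_of_finrank_pos (R := ℂ) (by omega)
  obtain ⟨γ₁, hγ₁⟩ := exists_ne (0 : LinearMap.ker (applyAt M z))
  obtain ⟨γ₂, hγ₂⟩ := exists_linearIndependent_pair_of_one_lt_finrank (R := ℂ) (by omega) hγ₁
  rw [LinearIndependent.pair_iff' hγ₁] at hγ₂
  have k₁ : M γ₁ *ᵥ z = 0 := γ₁.2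
  have k₂ : M γ₂ *ᵥ z = 0 := γ₂.2
  obtain ⟨y₀, hy₀⟩ := hM.exists_cross_ne_zero hdet (γ₁ := γ₁) (γ₂ := γ₂) (by simpa using hγ₁)
    (fun c hc => hγ₂ c (Subtype.ext hc.symm))
  set a := M α *ᵥ z
  set b := M β *ᵥ z
  have hall : ∀ y, (M γ₁ *ᵥ y) ⨯₃ (M γ₂ *ᵥ y) ≠ 0 → ∀ δ, (a ⨯₃ b) ⬝ᵥ (M δ *ᵥ y) = 0 := by
    intro y hy δ
    have p₁ := triple_product_polar hdet k₁ α β y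
    have p₂ := triple_product_polar hdet k₂ α β y
    have hspan : ∀ v, v ⬝ᵥ a ⨯₃ b = 0 → ∃ s t : ℂ, v = s • (M γ₁ *ᵥ y) + t • (M γ₂ *ᵥ y) := by
      intro v hv
      apply exists_eq_add_smul_of_triple_product hy
      obtain ⟨s₁, t₁, h₁⟩ := exists_eq_add_smul_of_triple_product h p₁.1
      obtain ⟨s₂, t₂, h₂⟩ := exists_eq_add_smul_of_triple_product h p₂.1
      obtain ⟨s, t, h₃⟩ := exists_eq_add_smul_of_triple_product h hv
      rw [h₁, h₂, h₃]
      simp [cross_apply, dotProduct, Fin.sum_univ_three]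
      ring
    -- The second polar identity is linear in `M γ y`, and here the vectors from `γ₁`, `γ₂` span the
    -- plane of `a` and `b`. Taking `v = a` and `v = b` will put `M α y` and `M β y` in this plane.
    have hlin : ∀ v, v ⬝ᵥ a ⨯₃ b = 0 →
        v ⬝ᵥ (M α *ᵥ y) ⨯₃ b + v ⬝ᵥ a ⨯₃ (M β *ᵥ y) = 0 := by
      intro v hv
      obtain ⟨s, t, rfl⟩ := hspan v hv
      simp only [add_dotProduct, smul_dotProduct, smul_eq_mul]
      linear_combination s * p₁.2 + t * p₂.2
    have hα := hlin a (dot_self_cross a b)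
    have hβ := hlin b (dot_cross_self a b)
    rw [dot_self_cross, add_zero] at hα
    rw [dot_cross_self, zero_add] at hβ
    obtain ⟨s, t, hst⟩ := exists_eq_add_smul_of_triple_product h (hdet δ α β z)
    -- This combination vanishes at `z`, so its value at `y` is in the plane. Hence all values of
    -- `M` lie in one plane, against nondegeneracy.
    have hδ := (triple_product_polar hdet (γ := δ - s • α - t • β) (z := z) (by
      simp only [map_sub, map_smul, sub_mulVec, smul_mulVec]
      rw [hst]; abel) α β y).1
    simp only [map_sub, map_smul, sub_mulVec, smul_mulVec, sub_dotProduct, smul_dotProduct,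
      smul_eq_mul] at hδ
    rw [dotProduct_comm]
    have e₁ : (M α *ᵥ y) ⬝ᵥ a ⨯₃ b = 0 := by
      rw [triple_product_permutation, ← cross_anticomm, dotProduct_neg, hα, neg_zero]
    have e₂ : (M β *ᵥ y) ⬝ᵥ a ⨯₃ b = 0 := by
      rw [triple_product_permutation, triple_product_permutation, ← cross_anticomm, dotProduct_neg,
        hβ, neg_zero]
    linear_combination hδ + s * e₁ + t * e₂
  refine h (hM.eq_zero_of_dotProduct fun δ y => ?_)
  have hc : Continuous fun y : Fin 3 → ℂ => (a ⨯₃ b) ⬝ᵥ (M δ *ᵥ y) := by fun_prop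
  exact congrFun (hc.ext_on (dense_cross_mulVec_ne_zero hy₀) continuous_const
    fun y hy => hall y hy δ) y

/-- If the evaluations of `M` have rank at most two and `k = 3`, then `T` vanishes on the images of
the matrices that vanish at a generic point. -/
theorem exists_apply_mulVec_eq_zero
    (hsymm : ∀ ξ p q, T ξ p q = T ξ q p)
    (hT : ∀ α z η, T (M α *ᵥ z) (evalVec M z η) (evalVec M z η) = 0)
    (hdet : ∀ α β γ z, (M α *ᵥ z) ⬝ᵥ (M β *ᵥ z) ⨯₃ (M γ *ᵥ z) = 0) (hk : k = 3)
    {α β : Fin k → ℂ} {z : Fin 3 → ℂ} (h : (M α *ᵥ z) ⨯₃ (M β *ᵥ z) ≠ 0) :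
    ∃ ν, ν ≠ 0 ∧ M ν *ᵥ z = 0 ∧ ∀ y, T (M ν *ᵥ y) = 0 := by
  have hrank := LinearMap.finrank_range_add_finrank_ker (applyAt M z)
  rw [finrank_range_applyAt hdet h, Module.finrank_fin_fun] at hrank
  obtain ⟨ν, hν0, hνz, hν⟩ := exists_ker_generator (M := M) (z := z) (by omega)
  obtain ⟨Ψ, hΨ⟩ := exists_factor hsymm hν0
  have hfac : ∀ y p, T (M ν *ᵥ y) p p = (ν ⬝ᵥ p) * (Ψ (M ν *ᵥ y) ⬝ᵥ p) := fun y =>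
    hΨ _ fun p hp => by
      obtain ⟨s, t, hst⟩ := exists_eq_add_smul_of_triple_product h
        (triple_product_polar hdet hνz α β y).1
      have := apply_self_eq_zero_of_dotProduct (hT · z) hν (s • α + t • β) p hp
      rwa [map_add, map_smul, map_smul, add_mulVec, smul_mulVec, smul_mulVec, ← hst] at this
  have hdiag : ∀ y, M (Ψ (M ν *ᵥ y)) *ᵥ y = 0 := by
    intro y
    rcases eq_zero_or_eq_zero_of_dotProduct_mul (a := M ν *ᵥ y) (b := M (Ψ (M ν *ᵥ y)) *ᵥ y)
      (fun η => by rw [← dotProduct_evalVec, ← dotProduct_evalVec, ← hfac, hT]) with h0 | h0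
    · rw [h0, map_zero, map_zero, zero_mulVec]
    · exact h0
  refine ⟨ν, hν0, hνz, fun y => eq_zero_of_diagonal hsymm fun p => ?_⟩
  -- The relation `hdiag` is quadratic in `y`. Polarising with `z`, where `M ν` vanishes, shows that
  -- `M (Ψ (M ν y))` kills `z`, so `Ψ (M ν y)` is a multiple of `ν`.
  have hpol := hdiag (y + z)
  simp only [mulVec_add, hνz, hdiag, zero_add, add_zero] at hpol
  obtain ⟨c, hc⟩ := hν _ hpol
  have hy := hdiag y
  rw [← hc, map_smul, smul_mulVec, smul_eq_zero] at hy
  rw [hfac]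
  rcases hy with rfl | hy
  · rw [← hc, zero_smul, zero_dotProduct, mul_zero]
  · rw [hy, map_zero, zero_dotProduct, mul_zero]

/-- If `T ≠ 0`, its kernel lies in a hyperplane. The matrices with image in that hyperplane form a
proper subspace `L`, containing at each generic point a nonzero matrix that vanishes there. Varying
the point makes `L` two-dimensional, a pencil of evaluation rank at most one, which is impossible.
-/
theorem IsNondegenerateStarSpace.eq_zero_of_rank_two (hM : IsNondegenerateStarSpace M)
    (hsymm : ∀ ξ p q, T ξ p q = T ξ q p)
    (hT : ∀ α z η, T (M α *ᵥ z) (evalVec M z η) (evalVec M z η) = 0)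
    (hdet : ∀ α β γ z, (M α *ᵥ z) ⬝ᵥ (M β *ᵥ z) ⨯₃ (M γ *ᵥ z) = 0) (hk : k = 3)
    {α β : Fin k → ℂ} {z : Fin 3 → ℂ} (h : (M α *ᵥ z) ⨯₃ (M β *ᵥ z) ≠ 0) : T = 0 := by
  by_contra hT0
  have hlt : LinearMap.ker T < ⊤ := lt_top_iff_ne_top.2 (by rwa [Ne, LinearMap.ker_eq_top])
  obtain ⟨g, hg0, hg⟩ := Submodule.exists_le_ker_of_lt_top _ hlt
  let L : Submodule ℂ (Fin k → ℂ) :=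
    { carrier := {γ | ∀ y, g (M γ *ᵥ y) = 0}
      zero_mem' := fun y => by simp
      add_mem' := fun {a b} ha hb y => by rw [map_add, add_mulVec, map_add, ha, hb, add_zero]
      smul_mem' := fun c a ha y => by rw [map_smul, smul_mulVec, map_smul, ha, smul_zero] }
  have hL : L ≠ ⊤ := by
    intro hL
    apply hg0
    have := hM.eq_zero_of_dotProduct (w := fun l => g (Pi.single l 1)) fun γ y => by
      rw [← LinearMap.apply_eq_dotProduct]
      have hγ : γ ∈ L := by rw [hL]; exact Submodule.mem_top
      exact hγ y
    ext l
    simpa using congrFun this l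
  have hgood : ∀ y, (M α *ᵥ y) ⨯₃ (M β *ᵥ y) ≠ 0 → ∃ ν ∈ L, ν ≠ 0 ∧ M ν *ᵥ y = 0 := by
    intro y hy
    obtain ⟨ν, hν0, hνy, hν⟩ := exists_apply_mulVec_eq_zero hsymm hT hdet hk hy
    exact ⟨ν, fun x => hg (hν x), hν0, hνy⟩
  have hd := dense_cross_mulVec_ne_zero h
  obtain ⟨ν₁, hL₁, hν₁, -⟩ := hgood z h
  obtain ⟨x, hx⟩ : ∃ x, M ν₁ *ᵥ x ≠ 0 := by
    by_contra! h'
    exact hν₁ (hM.eq_zero_of_mulVec h')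
  obtain ⟨y, hy, hy'⟩ := hd.inter_open_nonempty {x | M ν₁ *ᵥ x ≠ 0}
    (isOpen_ne_fun (by fun_prop) continuous_const) ⟨x, hx⟩
  obtain ⟨ν₂, hL₂, hν₂, h₂⟩ := hgood y hy'
  have hind : ∀ c : ℂ, ν₂ ≠ c • ν₁ := by
    rintro c rfl
    rw [map_smul, smul_mulVec, smul_eq_zero] at h₂
    rcases h₂ with rfl | h₂
    · exact hν₂ (zero_smul _ _)
    · exact hy h₂
  have hli : LinearIndependent ℂ ![ν₁, ν₂] := by
    rw [LinearIndependent.pair_iff' hν₁]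
    exact fun c hc => hind c hc.symm
  have hspan : Submodule.span ℂ (Set.range ![ν₁, ν₂]) = L := by
    apply Submodule.eq_of_le_of_finrank_le
    · rw [Submodule.span_le, Matrix.range_cons_cons_empty]
      rintro _ (rfl | rfl)
      · exact hL₁
      · exact hL₂
    · rw [finrank_span_eq_card hli, Fintype.card_fin]
      have := Submodule.finrank_lt hL
      rw [Module.finrank_fin_fun] at this
      omega
  obtain ⟨y₀, hy₀⟩ := hM.exists_cross_ne_zero hdet hν₁ hind
  -- A nonzero member of the pencil vanishing at `y` is a linear relation between the two values at
  -- `y`.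
  have hcross : ∀ y, (M α *ᵥ y) ⨯₃ (M β *ᵥ y) ≠ 0 → (M ν₁ *ᵥ y) ⨯₃ (M ν₂ *ᵥ y) = 0 := by
    intro y hy
    obtain ⟨ν, hνL, hν0, hνy⟩ := hgood y hy
    rw [← hspan, Matrix.range_cons_cons_empty, Submodule.mem_span_pair] at hνL
    obtain ⟨s, t, rfl⟩ := hνL
    rw [map_add, map_smul, map_smul, add_mulVec, smul_mulVec, smul_mulVec] at hνy
    by_contra hne
    rw [← ne_eq, crossProduct_ne_zero_iff_linearIndependent, LinearIndependent.pair_iff] at hne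
    obtain ⟨rfl, rfl⟩ := hne s t hνy
    exact hν0 (by simp)
  have hc := continuous_cross_mulVec (M ν₁) (M ν₂)
  have heq := hc.ext_on hd continuous_const hcross
  exact hy₀ (congrFun heq y₀)

theorem IsNondegenerateStarSpace.eq_zero_of_three (hM : IsNondegenerateStarSpace M)
    (hsymm : ∀ ξ p q, T ξ p q = T ξ q p)
    (hT : ∀ α z η, T (M α *ᵥ z) (evalVec M z η) (evalVec M z η) = 0) (hk : k = 3 ∨ k = 4) :
    T = 0 := by
  by_cases hdet : ∀ α β γ z, (M α *ᵥ z) ⬝ᵥ (M β *ᵥ z) ⨯₃ (M γ *ᵥ z) = 0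
  -- Any two independent parameters serve to show that the rank two is attained.
  · obtain ⟨z, hz⟩ := hM.exists_cross_ne_zero hdet
      (γ₁ := Pi.single ⟨0, by omega⟩ 1) (γ₂ := Pi.single ⟨1, by omega⟩ 1) (by simp)
      (fun c hc => by simpa [Pi.single_apply, Fin.ext_iff] using congrFun hc ⟨1, by omega⟩)
    have := hM.le_three hdet hz
    exact hM.eq_zero_of_rank_two hsymm hT hdet (by omega) hz
  · push Not at hdet
    obtain ⟨α, β, γ, z, h⟩ := hdet
    exact hM.eq_zero_of_triple_product_ne_zero hsymm hT (by omega) h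

end

/-! ### The case n = 2, k = 4. -/

section
variable {k : ℕ} {M : (Fin k → ℂ) →ₗ[ℂ] Matrix (Fin 2) (Fin 2) ℂ}
  {T : (Fin 2 → ℂ) →ₗ[ℂ] (Fin k → ℂ) →ₗ[ℂ] (Fin k → ℂ) →ₗ[ℂ] ℂ}

/-- Testing the solvability condition on the rank-one matrices `ξ z̄ᵀ` gives `T ξ w (evalVec M z η)
= κ w z * (ξ ⬝ᵥ η)`. For `w = evalVec M y θ`, symmetry of `T` exchanges the two evaluations; a
nonzero `ξ` orthogonal to `θ`, with `η = star ξ`, then forces `κ = 0`. -/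
theorem IsNondegenerateStarSpace.eq_zero_of_two (hM : IsNondegenerateStarSpace M)
    (hsurj : Function.Surjective M) (hsymm : ∀ ξ p q, T ξ p q = T ξ q p)
    (hT : ∀ w z, ∃ b, ∀ α η, (M α *ᵥ b) ⬝ᵥ η = T (M α *ᵥ z) w (evalVec M z η)) : T = 0 := by
  have h1 : ∀ w z, ∃ κ : ℂ, ∀ ξ η, T ξ w (evalVec M z η) = κ * (ξ ⬝ᵥ η) := by
    intro w z
    by_cases hz : z = 0
    · exact ⟨0, fun ξ η => by rw [hz, evalVec_zero_left, map_zero, zero_mul]⟩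
    obtain ⟨b, hb⟩ := hT w z
    have hzz : star z ⬝ᵥ z ≠ 0 := by rwa [Ne, dotProduct_star_self_eq_zero]
    refine ⟨(star z ⬝ᵥ z)⁻¹ * (star z ⬝ᵥ b), fun ξ η => ?_⟩
    obtain ⟨α, hα⟩ := hsurj (vecMulVec ξ (star z))
    have := hb α η
    simp only [hα, vecMulVec_mulVec, op_smul_eq_smul, smul_dotProduct, smul_eq_mul,
      map_smul, LinearMap.smul_apply] at this
    field_simp
    linear_combination -this
  choose κ hκ using h1
  have h2 : ∀ y θ z, θ ≠ 0 → κ (evalVec M y θ) z = 0 := by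
    intro y θ z hθ
    have hξ : (![-θ 1, θ 0] : Fin 2 → ℂ) ≠ 0 := by
      intro h
      have h0 := congrFun h 0
      have h1 := congrFun h 1
      apply hθ
      ext i
      fin_cases i <;> simp_all
    have e := hsymm ![-θ 1, θ 0] (evalVec M y θ) (evalVec M z (star ![-θ 1, θ 0]))
    rw [hκ, hκ] at e
    have : ![-θ 1, θ 0] ⬝ᵥ θ = 0 := by simp [dotProduct, Fin.sum_univ_two]; ring
    rw [this, mul_zero] at e
    refine (mul_eq_zero.1 e).resolve_right ?_
    rwa [dotProduct_self_star_eq_zero]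
  refine LinearMap.ext fun ξ => hM.eq_zero_of_evalVec _ fun y θ =>
    hM.eq_zero_of_evalVec _ fun z η => ?_
  by_cases hθ : θ = 0
  · rw [hθ, map_zero, map_zero, LinearMap.zero_apply]
  · rw [hκ, h2 y θ z hθ, zero_mul]

end

/-! ### The matrix space of a quadric. -/

namespace Quadric
variable {n k : ℕ}

/-- The complex linear combinations of the coordinate Hermitian forms. -/
def matrixMap (Q : Quadric n k) : (Fin k → ℂ) →ₗ[ℂ] Matrix (Fin n) (Fin n) ℂ :=
  Fintype.linearCombination ℂ Q.H

theorem matrixMap_apply (Q : Quadric n k) (α : Fin k → ℂ) : Q.matrixMap α = ∑ j, α j • Q.H j := rfl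

@[simp] theorem matrixMap_single (Q : Quadric n k) (j : Fin k) :
    Q.matrixMap (Pi.single j 1) = Q.H j := by
  simp [matrixMap]

theorem form_apply (Q : Quadric n k) (z ζ : Fin n → ℂ) (j : Fin k) :
    Q.form z ζ j = (Q.H j *ᵥ z) ⬝ᵥ star ζ := rfl

theorem evalVec_matrixMap (Q : Quadric n k) (z η : Fin n → ℂ) :
    evalVec Q.matrixMap z η = Q.form z (star η) := by
  ext j
  simp [evalVec, form_apply]

theorem star_form_apply (Q : Quadric n k) (z ζ : Fin n → ℂ) (j : Fin k) :
    star (Q.form z ζ j) = Q.form ζ z j := by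
  rw [form_apply, form_apply, ← star_dotProduct_star, star_star, star_mulVec,
    (Q.isHermitian j).eq, dotProduct_comm, ← dotProduct_mulVec, dotProduct_comm]

theorem matrixMap_star (Q : Quadric n k) (α : Fin k → ℂ) :
    Q.matrixMap (star α) = (Q.matrixMap α)ᴴ := by
  rw [matrixMap_apply, matrixMap_apply, conjTranspose_sum]
  refine Finset.sum_congr rfl fun j _ => ?_
  rw [conjTranspose_smul, (Q.isHermitian j).eq, Pi.star_apply]

/-- A complex relation among Hermitian matrices and its adjoint combine into two real relations, so
independence over `ℝ` yields independence over `ℂ`. -/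
theorem Nondegenerate.isNondegenerateStarSpace {Q : Quadric n k} (hQ : Q.Nondegenerate) :
    IsNondegenerateStarSpace Q.matrixMap where
  injective := by
    have hreal : ∀ r : Fin k → ℝ, Q.matrixMap (fun j => (r j : ℂ)) = 0 → r = 0 := by
      intro r hr
      rw [matrixMap_apply] at hr
      funext j
      exact Fintype.linearIndependent_iff.1 hQ.2 r (by simpa using hr) j
    intro α hα
    have hα' : Q.matrixMap (star α) = 0 := by rw [matrixMap_star, hα, conjTranspose_zero]
    have hre : (fun j => ((α j).re : ℂ)) = (1 / 2 : ℂ) • (α + star α) := by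
      ext j
      simp [Complex.re_eq_add_conj]
      ring
    have him : (fun j => ((α j).im : ℂ)) = (1 / (2 * Complex.I) : ℂ) • (α - star α) := by
      ext j
      simp [Complex.im_eq_sub_conj]
      field_simp
      rw [Complex.I_sq, mul_neg_one, neg_neg]
    have h1 := hreal (fun j => (α j).re) (by rw [hre, map_smul, map_add, hα, hα']; simp)
    have h2 := hreal (fun j => (α j).im) (by rw [him, map_smul, map_sub, hα, hα']; simp)
    funext j
    exact Complex.ext (congrFun h1 j) (congrFun h2 j)
  exists_conjTranspose α := ⟨star α, Q.matrixMap_star α⟩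
  ker_eq_zero e he := by
    refine hQ.1 e fun z => ?_
    ext j
    rw [form_apply, ← matrixMap_single, he, zero_dotProduct]
    rfl

end Quadric

/-! ### Weighted homogeneous polynomials. -/

section
variable {n k : ℕ} {p : MvPolynomial (Fin n ⊕ Fin k) ℂ}

theorem weight_varWeight (d : Fin n ⊕ Fin k →₀ ℕ) :
    Finsupp.weight (varWeight n k) d =
      ((∑ i, d (Sum.inl i) + 2 * ∑ j, d (Sum.inr j) : ℕ) : ℤ) := by
  rw [Finsupp.weight_apply, Finsupp.sum_fintype _ _ (by simp), Fintype.sum_sum_type]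
  simp [varWeight, Finset.mul_sum, mul_comm]

theorem sum_eq_of_isWeightedHomogeneous {N : ℕ}
    (hp : p.IsWeightedHomogeneous (varWeight n k) (N : ℤ)) {d : Fin n ⊕ Fin k →₀ ℕ}
    (hd : d ∈ p.support) : ∑ i, d (Sum.inl i) + 2 * ∑ j, d (Sum.inr j) = N := by
  have := hp (MvPolynomial.mem_support_iff.1 hd)
  rw [weight_varWeight] at this
  exact_mod_cast this

theorem eval_sumElim (z : Fin n → ℂ) (w : Fin k → ℂ) :
    MvPolynomial.eval (Sum.elim z w) p = ∑ d ∈ p.support,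
      p.coeff d * ((∏ i, z i ^ d (Sum.inl i)) * ∏ j, w j ^ d (Sum.inr j)) := by
  simp [MvPolynomial.eval_eq', Fintype.prod_sum_type]

theorem eval_smul {N : ℕ} (hp : p.IsWeightedHomogeneous (varWeight n k) (N : ℤ)) (t : ℂ)
    (z : Fin n → ℂ) (w : Fin k → ℂ) :
    MvPolynomial.eval (Sum.elim (t • z) (t ^ 2 • w)) p =
      t ^ N * MvPolynomial.eval (Sum.elim z w) p := by
  rw [eval_sumElim, eval_sumElim, Finset.mul_sum]
  refine Finset.sum_congr rfl fun d hd => ?_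
  rw [← sum_eq_of_isWeightedHomogeneous hp hd]
  simp only [Pi.smul_apply, smul_eq_mul, mul_pow, Finset.prod_mul_distrib, Finset.prod_pow_eq_pow_sum,
    pow_add, pow_mul]
  ring

/-- The dependence on `z` of a polynomial of even weight is of second order. -/
theorem exists_eval_smul_eq (hp : p.IsWeightedHomogeneous (varWeight n k) ((4 : ℕ) : ℤ)) :
    ∃ R : ℂ × (Fin n → ℂ) × (Fin k → ℂ) → ℂ, Continuous R ∧ ∀ t z w,
      MvPolynomial.eval (Sum.elim (t • z) w) p =
        MvPolynomial.eval (Sum.elim 0 w) p + t ^ 2 * R (t, z, w) := by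
  refine ⟨fun x => ∑ d ∈ p.support, p.coeff d * if ∑ i, d (Sum.inl i) = 0 then 0 else
    x.1 ^ (∑ i, d (Sum.inl i) - 2) *
      ((∏ i, x.2.1 i ^ d (Sum.inl i)) * ∏ j, x.2.2 j ^ d (Sum.inr j)), ?_, fun t z w => ?_⟩
  · refine continuous_finsetSum _ fun d _ => continuous_const.mul ?_
    split_ifs
    · exact continuous_const
    · fun_prop
  · rw [eval_sumElim, eval_sumElim, Finset.mul_sum, ← Finset.sum_add_distrib]
    refine Finset.sum_congr rfl fun d hd => ?_
    have hN := sum_eq_of_isWeightedHomogeneous hp hd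
    simp only [Pi.smul_apply, smul_eq_mul, mul_pow, Finset.prod_mul_distrib,
      Finset.prod_pow_eq_pow_sum, Pi.zero_apply]
    split_ifs with h0
    · have h1 := fun i => (Finset.sum_eq_zero_iff.1 h0) i (Finset.mem_univ i)
      simp [h1]
    -- The degree in `z` is even because the total weight is, so it is at least two once nonzero.
    · obtain ⟨e, he⟩ : ∃ e, ∑ i, d (Sum.inl i) = e + 2 := ⟨∑ i, d (Sum.inl i) - 2, by omega⟩
      rw [he, zero_pow (by omega), Nat.add_sub_cancel, pow_add]
      ring

theorem isWeightedHomogeneous_nat {N : ℕ}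
    (hp : p.IsWeightedHomogeneous (varWeight n k) (N : ℤ)) :
    p.IsWeightedHomogeneous (Sum.elim (fun _ => 1) (fun _ => 2) : Fin n ⊕ Fin k → ℕ) N := by
  intro d hd
  rw [← sum_eq_of_isWeightedHomogeneous hp (MvPolynomial.mem_support_iff.2 hd),
    Finsupp.weight_apply, Finsupp.sum_fintype _ _ (by simp), Fintype.sum_sum_type]
  simp [Finset.mul_sum, mul_comm]

/-- Euler's weighted identity at `z = 0`, where only the variables of weight two contribute. -/
theorem eval_pderiv {N : ℕ} (hp : p.IsWeightedHomogeneous (varWeight n k) ((N : ℕ) : ℤ))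
    (w : Fin k → ℂ) : N * MvPolynomial.eval (Sum.elim 0 w) p =
      2 * ∑ j, w j * MvPolynomial.eval (Sum.elim 0 w) (MvPolynomial.pderiv (Sum.inr j) p) := by
  have := congrArg (MvPolynomial.eval (Sum.elim 0 w))
    (isWeightedHomogeneous_nat hp).sum_weight_X_mul_pderiv
  simp only [Fintype.sum_sum_type, Sum.elim_inl, Sum.elim_inr, map_add, map_sum, map_mul,
    MvPolynomial.eval_X, Pi.zero_apply, zero_mul, mul_zero, Finset.sum_const_zero, zero_add,
    nsmul_eq_mul, map_natCast] at this
  rw [← this, Finset.mul_sum]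
  simp

/-- A polynomial of weight four restricts to a quadratic form in `w`. -/
theorem exists_bilinear (hp : p.IsWeightedHomogeneous (varWeight n k) ((4 : ℕ) : ℤ)) :
    ∃ B : (Fin k → ℂ) →ₗ[ℂ] (Fin k → ℂ) →ₗ[ℂ] ℂ, (∀ w v, B w v = B v w) ∧
      ∀ w, star (MvPolynomial.eval (Sum.elim 0 (star w)) p) = B w w := by
  let q : Fin k → Fin k → MvPolynomial (Fin n ⊕ Fin k) ℂ := fun j l =>
    MvPolynomial.pderiv (Sum.inr l) (MvPolynomial.pderiv (Sum.inr j) p)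
  have h2 : ∀ j, (MvPolynomial.pderiv (Sum.inr j) p).IsWeightedHomogeneous (varWeight n k)
      ((2 : ℕ) : ℤ) := fun j => hp.pderiv (by simp [varWeight])
  have h0 : ∀ j l, (q j l).IsWeightedHomogeneous (varWeight n k) ((0 : ℕ) : ℤ) :=
    fun j l => (h2 j).pderiv (by simp [varWeight])
  have hq : ∀ j l w, MvPolynomial.eval (Sum.elim 0 w) (q j l) =
      MvPolynomial.eval (Sum.elim 0 0) (q j l) := by
    intro j l w
    have := eval_smul (h0 j l) 0 0 w
    simpa using this.symm
  let c : Matrix (Fin k) (Fin k) ℂ := fun j l =>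
    star (MvPolynomial.eval (Sum.elim 0 0) (q j l))
  let B : (Fin k → ℂ) →ₗ[ℂ] (Fin k → ℂ) →ₗ[ℂ] ℂ := Matrix.toLinearMap₂' ℂ c
  -- One factor 1/2 comes from Taylor's formula, the other from symmetrising, which avoids commuting
  -- the second derivatives.
  refine ⟨(1 / 4 : ℂ) • (B + B.flip), fun w v => ?_, fun w => ?_⟩
  · simp [add_comm]
  · have e : MvPolynomial.eval (Sum.elim 0 (star w)) p =
        (1 / 2 : ℂ) * ∑ j, ∑ l, star w j * (star w l * MvPolynomial.eval (Sum.elim 0 0) (q j l)) := by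
      have e1 := eval_pderiv hp (star w)
      have e2 : ∀ j, MvPolynomial.eval (Sum.elim 0 (star w)) (MvPolynomial.pderiv (Sum.inr j) p) =
          ∑ l, star w l * MvPolynomial.eval (Sum.elim 0 0) (q j l) := fun j => by
        have := eval_pderiv (h2 j) (star w)
        simp only [← hq j _ (star w)]
        linear_combination this / 2
      simp only [e2, Finset.mul_sum] at e1 ⊢
      push_cast at e1
      have e3 : ∀ a b : ℂ, 4 * a = b → a = b / 4 := fun a b h => by linear_combination h / 4
      rw [e3 _ _ e1, Finset.sum_div]
      refine Finset.sum_congr rfl fun j _ => ?_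
      rw [Finset.sum_div]
      exact Finset.sum_congr rfl fun l _ => by ring
    have hB : B w w = ∑ j, ∑ l, w j * (w l * c j l) := by
      rw [Matrix.toLinearMap₂'_apply c w w]
      simp [smul_eq_mul]
    rw [e, LinearMap.smul_apply, LinearMap.smul_apply, LinearMap.add_apply, LinearMap.add_apply,
      LinearMap.flip_apply, hB]
    simp only [c, star_mul', star_sum, Pi.star_apply, star_star, smul_eq_mul, star_div₀, star_one,
      star_ofNat]
    ring

end

/-! ### Polynomial functions and their real points. -/

section
variable {σ τ : Type*}

/-- Functions given by polynomials. -/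
def IsPolynomialFun (φ : (σ → ℂ) → ℂ) : Prop :=
  ∃ p : MvPolynomial σ ℂ, ∀ v, φ v = MvPolynomial.eval v p

namespace IsPolynomialFun
variable {φ ψ : (σ → ℂ) → ℂ}

theorem const (c : ℂ) : IsPolynomialFun fun _ : σ → ℂ => c := ⟨MvPolynomial.C c, by simp⟩

theorem coord (i : σ) : IsPolynomialFun fun v : σ → ℂ => v i := ⟨MvPolynomial.X i, by simp⟩

theorem add (hφ : IsPolynomialFun φ) (hψ : IsPolynomialFun ψ) :
    IsPolynomialFun fun v => φ v + ψ v := by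
  obtain ⟨p, hp⟩ := hφ
  obtain ⟨q, hq⟩ := hψ
  exact ⟨p + q, by simp [hp, hq]⟩

theorem mul (hφ : IsPolynomialFun φ) (hψ : IsPolynomialFun ψ) :
    IsPolynomialFun fun v => φ v * ψ v := by
  obtain ⟨p, hp⟩ := hφ
  obtain ⟨q, hq⟩ := hψ
  exact ⟨p * q, by simp [hp, hq]⟩

theorem sub (hφ : IsPolynomialFun φ) (hψ : IsPolynomialFun ψ) :
    IsPolynomialFun fun v => φ v - ψ v := by
  simpa [sub_eq_add_neg] using hφ.add ((const (-1)).mul hψ)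

theorem sum {ι : Type*} {s : Finset ι} {φ : ι → (σ → ℂ) → ℂ} (h : ∀ i, IsPolynomialFun (φ i)) :
    IsPolynomialFun fun v => ∑ i ∈ s, φ i v := by
  choose p hp using h
  exact ⟨∑ i ∈ s, p i, by simp [hp]⟩

theorem eval {h : τ → (σ → ℂ) → ℂ} (hh : ∀ i, IsPolynomialFun (h i)) (p : MvPolynomial τ ℂ) :
    IsPolynomialFun fun v => MvPolynomial.eval (fun i => h i v) p := by
  choose q hq using hh
  refine ⟨MvPolynomial.bind₁ q p, fun v => ?_⟩
  simp only [hq]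
  exact (MvPolynomial.eval₂Hom_bind₁ (RingHom.id ℂ) v q p).symm

/-- The two conjugations cancel on the variables and leave the polynomial with conjugated
coefficients. -/
theorem star_eval {h : τ → (σ → ℂ) → ℂ} (hh : ∀ i, IsPolynomialFun (h i)) (p : MvPolynomial τ ℂ) :
    IsPolynomialFun fun v => star (MvPolynomial.eval (fun i => star (h i v)) p) := by
  convert eval hh (MvPolynomial.map (starRingEnd ℂ) p) using 2 with v
  have := MvPolynomial.map_eval (starRingEnd ℂ) (fun i => star (h i v)) p
  simpa [Function.comp_def] using this

/-- A polynomial that vanishes at the real points vanishes. -/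
theorem eq_zero_of_real (hφ : IsPolynomialFun φ) (h : ∀ r : σ → ℝ, φ (fun i => (r i : ℂ)) = 0)
    (v : σ → ℂ) : φ v = 0 := by
  obtain ⟨p, hp⟩ := hφ
  have : p = 0 := MvPolynomial.funext_set (fun _ => Set.range ((↑) : ℝ → ℂ))
    (fun _ => Set.infinite_range_of_injective Complex.ofReal_injective) fun x hx => by
      choose r hr using fun i => hx i (Set.mem_univ i)
      obtain rfl : (fun i => (r i : ℂ)) = x := funext hr
      rw [← hp, h, map_zero]
  rw [hp, this, map_zero]

end IsPolynomialFun
end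

/-! ### From tangent fields of weight three to trilinear forms. -/

namespace Quadric
variable {n k : ℕ}

section
variable {Q : Quadric n k} {f : Fin n → MvPolynomial (Fin n ⊕ Fin k) ℂ}
  {g : Fin k → MvPolynomial (Fin n ⊕ Fin k) ℂ}

theorem smul_mem_carrier {z : Fin n → ℂ} {w : Fin k → ℂ} (h : (z, w) ∈ Q.carrier) (t : ℝ) :
    ((t : ℂ) • z, (t : ℂ) ^ 2 • w) ∈ Q.carrier := by
  intro j
  have hj : (w j).im - (Q.form z z j).re = 0 := h j
  have e : Q.form ((t : ℂ) • z) ((t : ℂ) • z) j = ((t ^ 2 : ℝ) : ℂ) * Q.form z z j := by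
    rw [form_apply, form_apply, mulVec_smul, star_smul, smul_dotProduct, dotProduct_smul]
    simp
    ring
  have e' : ((t : ℂ) ^ 2 • w) j = ((t ^ 2 : ℝ) : ℂ) * w j := by simp
  change (((t : ℂ) ^ 2 • w) j).im - (Q.form ((t : ℂ) • z) ((t : ℂ) • z) j).re = 0
  rw [e, e', Complex.im_ofReal_mul, Complex.re_ofReal_mul, ← mul_sub, hj, mul_zero]

/-- A weighted homogeneous field of weight three tangent to the quadric near the origin satisfies
the tangency equation at all points of the quadric. -/
theorem re_eq_zero_of_eventually_tangent
    (hf : ∀ i, (f i).IsWeightedHomogeneous (varWeight n k) ((4 : ℕ) : ℤ))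
    (hg : ∀ j, (g j).IsWeightedHomogeneous (varWeight n k) ((5 : ℕ) : ℤ))
    (h : ∀ᶠ p in 𝓝 (0 : Ambient n k), p ∈ Q.carrier → Q.IsTangentAt p (polyField f g p))
    {z : Fin n → ℂ} {w : Fin k → ℂ} (hp : (z, w) ∈ Q.carrier) (j : Fin k) :
    (Complex.I * (polyField f g (z, w)).2 j + 2 * Q.form (polyField f g (z, w)).1 z j).re = 0 := by
  have hlim : Tendsto (fun t : ℝ => (((t : ℂ) • z, (t : ℂ) ^ 2 • w) : Ambient n k)) (𝓝[≠] 0)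
      (𝓝 0) := by
    have hc : Continuous fun t : ℝ => (((t : ℂ) • z, (t : ℂ) ^ 2 • w) : Ambient n k) := by fun_prop
    have := hc.tendsto 0
    simp only [Complex.ofReal_zero, zero_smul, ne_eq, OfNat.ofNat_ne_zero, not_false_eq_true,
      zero_pow] at this
    exact this.mono_left nhdsWithin_le_nhds
  obtain ⟨t, ht, ht0⟩ := ((hlim.eventually h).and self_mem_nhdsWithin).exists
  have htan := (Q.isTangentAt_iff _ _).1 (ht (smul_mem_carrier hp t)) j
  have h1 : (polyField f g ((t : ℂ) • z, (t : ℂ) ^ 2 • w)).1 =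
      (t : ℂ) ^ 4 • (polyField f g (z, w)).1 := by
    ext i
    exact eval_smul (hf i) t z w
  have h2 : (polyField f g ((t : ℂ) • z, (t : ℂ) ^ 2 • w)).2 =
      (t : ℂ) ^ 5 • (polyField f g (z, w)).2 := by
    ext i
    exact eval_smul (hg i) t z w
  have e : Complex.I * (polyField f g ((t : ℂ) • z, (t : ℂ) ^ 2 • w)).2 j +
      2 * Q.form (polyField f g ((t : ℂ) • z, (t : ℂ) ^ 2 • w)).1 ((t : ℂ) • z) j =
      ((t ^ 5 : ℝ) : ℂ) * (Complex.I * (polyField f g (z, w)).2 j +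
        2 * Q.form (polyField f g (z, w)).1 z j) := by
    rw [h1, h2, form_apply, form_apply, mulVec_smul, star_smul, smul_dotProduct, dotProduct_smul]
    simp
    ring
  change 2 * (Complex.I * (polyField f g ((t : ℂ) • z, (t : ℂ) ^ 2 • w)).2 j +
    2 * Q.form (polyField f g ((t : ℂ) • z, (t : ℂ) ^ 2 • w)).1 ((t : ℂ) • z) j).re = 0 at htan
  rw [e, Complex.re_ofReal_mul] at htan
  have ht0' : t ≠ 0 := ht0
  have : t ^ 5 ≠ 0 := pow_ne_zero _ ht0'
  simpa [this] using htan

/-- The tangency equation, complexified: `z` and `z̄` become independent variables. -/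
theorem complexified_tangency
    (h : ∀ z w, (z, w) ∈ Q.carrier → ∀ j, (Complex.I * (polyField f g (z, w)).2 j +
      2 * Q.form (polyField f g (z, w)).1 z j).re = 0) (z ζ : Fin n → ℂ) (w τ : Fin k → ℂ)
    (hτ : τ = w - (2 * Complex.I) • Q.form z ζ) (j : Fin k) :
    Complex.I * (polyField f g (z, w)).2 j + 2 * Q.form (polyField f g (z, w)).1 ζ j +
      star (Complex.I * (polyField f g (ζ, star τ)).2 j +
        2 * Q.form (polyField f g (ζ, star τ)).1 z j) = 0 := by
  -- The real and imaginary parts of `z` and the real part of `w` parametrize the quadric. At real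
  -- parameters `Z`, `Z'`, `W`, `W'` are `z`, `z̄`, `w`, `w̄`; at complex ones they solve the
  -- complexified equation.
  let Z : Fin n → (Fin n ⊕ Fin n ⊕ Fin k → ℂ) → ℂ := fun i v =>
    v (Sum.inl i) + Complex.I * v (Sum.inr (Sum.inl i))
  let Z' : Fin n → (Fin n ⊕ Fin n ⊕ Fin k → ℂ) → ℂ := fun i v =>
    v (Sum.inl i) - Complex.I * v (Sum.inr (Sum.inl i))
  let h₀ : Fin k → (Fin n ⊕ Fin n ⊕ Fin k → ℂ) → ℂ := fun j v =>
    ∑ a, (∑ b, Q.H j a b * Z b v) * Z' a v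
  let W : Fin k → (Fin n ⊕ Fin n ⊕ Fin k → ℂ) → ℂ := fun j v =>
    v (Sum.inr (Sum.inr j)) + Complex.I * h₀ j v
  let W' : Fin k → (Fin n ⊕ Fin n ⊕ Fin k → ℂ) → ℂ := fun j v =>
    v (Sum.inr (Sum.inr j)) - Complex.I * h₀ j v
  have hZ : ∀ i, IsPolynomialFun (Z i) := fun i => (.add (.coord _) (.mul (.const _) (.coord _)))
  have hZ' : ∀ i, IsPolynomialFun (Z' i) := fun i => (.sub (.coord _) (.mul (.const _) (.coord _)))
  have hh₀ : ∀ j, IsPolynomialFun (h₀ j) := fun j =>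
    .sum fun a => .mul (.sum fun b => .mul (.const _) (hZ b)) (hZ' a)
  have hW : ∀ j, IsPolynomialFun (W j) := fun j => .add (.coord _) (.mul (.const _) (hh₀ j))
  have hW' : ∀ j, IsPolynomialFun (W' j) := fun j => .sub (.coord _) (.mul (.const _) (hh₀ j))
  let X : Fin n ⊕ Fin k → (Fin n ⊕ Fin n ⊕ Fin k → ℂ) → ℂ := Sum.elim Z W
  let X' : Fin n ⊕ Fin k → (Fin n ⊕ Fin n ⊕ Fin k → ℂ) → ℂ := Sum.elim Z' W'
  have hX : ∀ i, IsPolynomialFun (X i) := Sum.rec hZ hW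
  have hX' : ∀ i, IsPolynomialFun (X' i) := Sum.rec hZ' hW'
  let Φ : (Fin n ⊕ Fin n ⊕ Fin k → ℂ) → ℂ := fun v =>
    Complex.I * MvPolynomial.eval (fun i => X i v) (g j) +
      2 * (∑ a, (∑ b, Q.H j a b * MvPolynomial.eval (fun i => X i v) (f b)) * Z' a v) +
      (star Complex.I * star (MvPolynomial.eval (fun i => star (X' i v)) (g j)) +
      2 * (∑ a, (∑ b, star (Q.H j a b) *
        star (MvPolynomial.eval (fun i => star (X' i v)) (f b))) * Z a v))
  have hΦ : IsPolynomialFun Φ :=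
    .add (.add (.mul (.const _) (.eval hX _)) (.mul (.const _) (.sum fun a => .mul
      (.sum fun b => .mul (.const _) (.eval hX _)) (hZ' a))))
      (.add (.mul (.const _) (.star_eval hX' _)) (.mul (.const _) (.sum fun a => .mul
      (.sum fun b => .mul (.const _) (.star_eval hX' _)) (hZ a))))
  have key : ∀ (v : Fin n ⊕ Fin n ⊕ Fin k → ℂ) (z ζ : Fin n → ℂ) (w τ : Fin k → ℂ),
      (∀ i, Z i v = z i) → (∀ i, Z' i v = star (ζ i)) → (∀ i, W i v = w i) →
      (∀ i, W' i v = τ i) →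
      Φ v = Complex.I * (polyField f g (z, w)).2 j + 2 * Q.form (polyField f g (z, w)).1 ζ j +
      star (Complex.I * (polyField f g (ζ, star τ)).2 j +
        2 * Q.form (polyField f g (ζ, star τ)).1 z j) := by
    intro v z ζ w τ e₁ e₂ e₃ e₄
    have eX : (fun i => X i v) = Sum.elim z w := by
      funext i
      rcases i with i | i
      · exact e₁ i
      · exact e₃ i
    have eX' : (fun i => star (X' i v)) = Sum.elim ζ (star τ) := by
      funext i
      rcases i with i | i
      · exact (congrArg star (e₂ i)).trans (star_star _)
      · exact congrArg star (e₄ i)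
    simp only [Φ, eX, eX', e₁, e₂, polyField, form, mulVec, dotProduct, star_add, star_mul',
      star_sum, star_star]
    norm_num
  have hh₀' : ∀ (v : Fin n ⊕ Fin n ⊕ Fin k → ℂ) (z ζ : Fin n → ℂ),
      (∀ i, Z i v = z i) → (∀ i, Z' i v = star (ζ i)) → ∀ i, h₀ i v = Q.form z ζ i := by
    intro v z ζ e₁ e₂ i
    simp only [h₀, e₁, e₂, form, mulVec, dotProduct]
  have hreal : ∀ r : Fin n ⊕ Fin n ⊕ Fin k → ℝ, Φ (fun i => (r i : ℂ)) = 0 := by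
    intro r
    set v : Fin n ⊕ Fin n ⊕ Fin k → ℂ := fun i => (r i : ℂ) with hv
    set z₀ : Fin n → ℂ := fun i => Z i v with hz₀
    have e₂ : ∀ i, Z' i v = star (z₀ i) := fun i => by
      simp [hz₀, Z, Z', hv]
      ring
    have e₃ := hh₀' v z₀ z₀ (fun _ => rfl) e₂
    set w₀ : Fin k → ℂ := fun i => W i v with hw₀
    have e₄ : ∀ i, W' i v = star w₀ i := fun i => by
      simp only [hw₀, W, W', e₃, Pi.star_apply, star_add, star_mul', star_form_apply]
      simp [hv]
      ring
    rw [key v z₀ z₀ w₀ (star w₀) (fun _ => rfl) e₂ (fun _ => rfl) e₄, star_star]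
    have hmem : (z₀, w₀) ∈ Q.carrier := by
      intro i
      change (w₀ i).im - (Q.form z₀ z₀ i).re = 0
      simp only [hw₀, W, e₃]
      simp [hv]
    have := h z₀ w₀ hmem j
    generalize Complex.I * (polyField f g (z₀, w₀)).2 j +
      2 * Q.form (polyField f g (z₀, w₀)).1 z₀ j = A at this ⊢
    have hA := Complex.add_conj A
    rw [this] at hA
    simpa using hA
  have hall := hΦ.eq_zero_of_real hreal
  let v : Fin n ⊕ Fin n ⊕ Fin k → ℂ := Sum.elim (fun i => (z i + star (ζ i)) / 2)
    (Sum.elim (fun i => (z i - star (ζ i)) / (2 * Complex.I))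
      (fun i => w i - Complex.I * Q.form z ζ i))
  have e₁ : ∀ i, Z i v = z i := fun i => by
    simp only [Z, v, Sum.elim_inl, Sum.elim_inr]
    field_simp
    ring
  have e₂ : ∀ i, Z' i v = star (ζ i) := fun i => by
    simp only [Z', v, Sum.elim_inl, Sum.elim_inr]
    field_simp
    ring
  have e₀ := hh₀' v z ζ e₁ e₂
  rw [← key v z ζ w τ e₁ e₂ (fun i => ?_) (fun i => ?_)]
  · exact hall v
  · simp only [W, e₀]
    simp [v]
  · simp only [W', e₀, hτ]
    simp [v]
    ring

end
section
variable {Q : Quadric n k} {f : Fin n → MvPolynomial (Fin n ⊕ Fin k) ℂ}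
  {g : Fin k → MvPolynomial (Fin n ⊕ Fin k) ℂ}

theorem form_smul_left (c : ℂ) (z ζ : Fin n → ℂ) (j : Fin k) :
    Q.form (c • z) ζ j = c * Q.form z ζ j := by
  rw [form_apply, form_apply, mulVec_smul, smul_dotProduct, smul_eq_mul]

theorem form_smul_right (c : ℂ) (z ζ : Fin n → ℂ) (j : Fin k) :
    Q.form z (c • ζ) j = star c * Q.form z ζ j := by
  rw [form_apply, form_apply, star_smul, dotProduct_smul, smul_eq_mul]

theorem form_sub_left (x z ζ : Fin n → ℂ) (j : Fin k) :
    Q.form (x - z) ζ j = Q.form x ζ j - Q.form z ζ j := by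
  simp only [form_apply, mulVec_sub, sub_dotProduct]

/-- The structure of a tangent field of weight three: it is determined by a trilinear form. -/
theorem exists_trilinear
    (hf : ∀ i, (f i).IsWeightedHomogeneous (varWeight n k) ((4 : ℕ) : ℤ))
    (hg : ∀ j, (g j).IsWeightedHomogeneous (varWeight n k) ((5 : ℕ) : ℤ))
    (h : ∀ z w, (z, w) ∈ Q.carrier → ∀ j, (Complex.I * (polyField f g (z, w)).2 j +
      2 * Q.form (polyField f g (z, w)).1 z j).re = 0) :
    ∃ T : (Fin n → ℂ) →ₗ[ℂ] (Fin k → ℂ) →ₗ[ℂ] (Fin k → ℂ) →ₗ[ℂ] ℂ,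
      (∀ ξ p q, T ξ p q = T ξ q p) ∧
      (∀ ξ w, ξ ⬝ᵥ star (polyField f g (0, star w)).1 = T ξ w w) ∧
      (∀ z w j, Complex.I * (polyField f g (z, w)).2 j = -2 * T (Q.H j *ᵥ z) w w) ∧
      (∀ z ζ w j, Q.form ((polyField f g (z, w)).1 - (polyField f g (0, w)).1) ζ j =
        4 * Complex.I * T (Q.H j *ᵥ z) w (Q.form z ζ)) ∧
      ∀ z ζ j, T (Q.H j *ᵥ z) (Q.form z ζ) (Q.form z ζ) = 0 := by
  choose B hBs hB using fun i => exists_bilinear (hf i)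
  choose R hRc hR using fun i => exists_eval_smul_eq (hf i)
  let T : (Fin n → ℂ) →ₗ[ℂ] (Fin k → ℂ) →ₗ[ℂ] (Fin k → ℂ) →ₗ[ℂ] ℂ :=
    Fintype.linearCombination ℂ B
  have hT : ∀ ξ p q, T ξ p q = ∑ i, ξ i * B i p q := fun ξ p q => by
    simp [T, Fintype.linearCombination_apply, LinearMap.sum_apply]
  have hsymm : ∀ ξ p q, T ξ p q = T ξ q p := fun ξ p q => by
    rw [hT, hT]
    exact Finset.sum_congr rfl fun i _ => by rw [hBs]
  have h0 : ∀ ξ w, ξ ⬝ᵥ star (polyField f g (0, star w)).1 = T ξ w w := fun ξ w => by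
    rw [hT]
    exact Finset.sum_congr rfl fun i _ => congrArg (ξ i * ·) (hB i w)
  have hseg := fun z ζ w j => complexified_tangency h z ζ w _ rfl j
  have hform0 : ∀ z w j, Q.form z (polyField f g (0, star w)).1 j = T (Q.H j *ᵥ z) w w :=
    fun z w j => h0 _ _
  have hform0' : ∀ z w j, Q.form (polyField f g (0, w)).1 z j =
      star (T (Q.H j *ᵥ z) (star w) (star w)) := fun z w j => by
    rw [← hform0, star_form_apply, star_star]
  -- The dilation by `-1` fixes `(0, w)` and changes the sign of a polynomial of odd weight.
  have hg0 : ∀ w j, (polyField f g ((0 : Fin n → ℂ), w)).2 j = 0 := fun w j => by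
    have := eval_smul (hg j) (-1) 0 w
    have e : ((-1 : ℂ) ^ 2) = 1 := by norm_num
    rw [smul_zero, e, one_smul] at this
    change MvPolynomial.eval (Sum.elim 0 w) (g j) = 0
    linear_combination this / 2
  have hG : ∀ z w j, Complex.I * (polyField f g (z, w)).2 j = -2 * T (Q.H j *ᵥ z) w w := by
    intro z w j
    have := hseg z 0 w j
    have e : ∀ y, Q.form y 0 = 0 := fun y => by ext j; simp [form_apply]
    simp only [e, smul_zero, sub_zero, hg0, mul_zero, zero_add, star_mul', star_form_apply, hform0,
      star_ofNat, Pi.zero_apply, add_zero] at this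
    linear_combination this
  let D : (Fin n → ℂ) → (Fin k → ℂ) → (Fin n → ℂ) := fun z w =>
    (polyField f g (z, w)).1 - (polyField f g (0, w)).1
  have hD : ∀ z w ζ j, Q.form (polyField f g (z, w)).1 ζ j =
      Q.form (D z w) ζ j + star (T (Q.H j *ᵥ ζ) (star w) (star w)) := fun z w ζ j => by
    rw [← hform0', form_sub_left, sub_add_cancel]
  have hmain : ∀ z ζ w j, Q.form (D z w) ζ j +
      4 * Complex.I * star (T (Q.H j *ᵥ ζ) (star w) (star (Q.form z ζ))) +
      4 * star (T (Q.H j *ᵥ ζ) (star (Q.form z ζ)) (star (Q.form z ζ))) =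
      4 * Complex.I * T (Q.H j *ᵥ z) w (Q.form z ζ) +
      4 * T (Q.H j *ᵥ z) (Q.form z ζ) (Q.form z ζ) -
      star (Q.form (D ζ (star (w - (2 * Complex.I) • Q.form z ζ))) z j) := by
    intro z ζ w j
    have := hseg z ζ w j
    rw [hG, hG, hD, hD, star_star] at this
    simp only [star_sub, star_smul, map_sub, map_smul, LinearMap.sub_apply, LinearMap.smul_apply,
      smul_eq_mul, star_add, star_mul', star_star, star_neg, star_ofNat,
      hsymm _ (Q.form z ζ) w, hsymm _ (star (Q.form z ζ)) (star w)] at this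
    have hI : star Complex.I = -Complex.I := Complex.conj_I
    simp only [hI, star_sub, star_smul, star_mul', star_ofNat] at this ⊢
    have hI2 := Complex.I_mul_I
    linear_combination this / 2 + (4 * star (T (Q.H j *ᵥ ζ) (star (Q.form z ζ)) (star (Q.form z ζ))) -
      4 * T (Q.H j *ᵥ z) (Q.form z ζ) (Q.form z ζ)) * hI2
  -- Replace `ζ` by `t ζ` with `t` real in `hmain`: all terms other than these two are of order
  -- `t²`, including the one with `D`, so the coefficients of `t` agree.
  have h1 : ∀ z ζ w j, Q.form (D z w) ζ j = 4 * Complex.I * T (Q.H j *ᵥ z) w (Q.form z ζ) := by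
    intro z ζ w j
    have hform : ∀ t : ℝ, Q.form z ((t : ℂ) • ζ) = (t : ℂ) • Q.form z ζ := fun t => by
      ext j
      rw [form_smul_right]
      simp
    have hDR : ∀ (t : ℂ) (y : Fin n → ℂ) (v : Fin k → ℂ), D (t • y) v =
        t ^ 2 • fun i => R i (t, y, v) := fun t y v => by
      ext i
      change MvPolynomial.eval (Sum.elim (t • y) v) (f i) - MvPolynomial.eval (Sum.elim 0 v) (f i) =
        t ^ 2 * R i (t, y, v)
      rw [hR]
      ring
    let V : ℝ → Fin n → ℂ := fun t i =>
      R i ((t : ℂ), ζ, star (w - (2 * Complex.I) • ((t : ℂ) • Q.form z ζ)))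
    have hV : Continuous V := continuous_pi fun i => (hRc i).comp (by fun_prop)
    let K : ℝ → ℂ := fun t => -(4 * Complex.I * star (T (Q.H j *ᵥ ζ) (star w) (star (Q.form z ζ)))) -
      4 * t * star (T (Q.H j *ᵥ ζ) (star (Q.form z ζ)) (star (Q.form z ζ))) +
      4 * T (Q.H j *ᵥ z) (Q.form z ζ) (Q.form z ζ) - star ((Q.H j *ᵥ V t) ⬝ᵥ star z)
    have hK : Continuous fun t : ℝ => (t : ℂ) * K t := by
      have : Continuous fun t : ℝ => (Q.H j *ᵥ V t) ⬝ᵥ star z :=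
        Continuous.dotProduct (Continuous.matrix_mulVec continuous_const hV) continuous_const
      fun_prop
    have heq : ∀ t ∈ ({0}ᶜ : Set ℝ), (t : ℂ) * K t =
        Q.form (D z w) ζ j - 4 * Complex.I * T (Q.H j *ᵥ z) w (Q.form z ζ) := by
      intro t ht
      have ht' : (t : ℂ) ≠ 0 := by exact_mod_cast ht
      have := hmain z ((t : ℂ) • ζ) w j
      rw [hform, hDR, form_smul_left, form_smul_right, form_apply (n := n) Q (fun i => R i _) z] at this
      have ht2 : star (t : ℂ) = t := Complex.conj_ofReal t
      simp only [mulVec_smul, map_smul, star_smul, LinearMap.smul_apply, smul_eq_mul, star_mul', ht2,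
        star_pow] at this
      apply mul_left_cancel₀ ht'
      simp only [K, V]
      simp only [star_smul, smul_smul, star_sub] at this ⊢
      linear_combination -this
    have := congrFun (hK.ext_on (dense_compl_singleton 0) continuous_const heq) 0
    rw [Complex.ofReal_zero, zero_mul] at this
    linear_combination -this
  have h2 : ∀ z ζ j, T (Q.H j *ᵥ z) (Q.form z ζ) (Q.form z ζ) =
      - star (T (Q.H j *ᵥ ζ) (star (Q.form z ζ)) (star (Q.form z ζ))) := by
    intro z ζ j
    have := hmain z ζ 0 j
    have e : Q.form ζ z = star (Q.form z ζ) := by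
      ext j
      rw [Pi.star_apply, star_form_apply]
    have hI : star Complex.I = -Complex.I := Complex.conj_I
    have ew : star ((0 : Fin k → ℂ) - (2 * Complex.I) • Q.form z ζ) =
        (2 * Complex.I) • star (Q.form z ζ) := by
      ext i
      simp
    rw [h1, h1, e, ew] at this
    simp only [map_smul, LinearMap.smul_apply, smul_eq_mul, star_mul', star_ofNat, hI, star_zero,
      map_zero, LinearMap.zero_apply, mul_zero, zero_add] at this
    have hI2 := Complex.I_mul_I
    linear_combination -this / 4 + 2 * star (T (Q.H j *ᵥ ζ) (star (Q.form z ζ)) (star (Q.form z ζ))) * hI2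
  refine ⟨T, hsymm, h0, hG, h1, fun z ζ j => ?_⟩
  have e₁ := h2 z ζ j
  -- In `h2` the left side is even in `ζ` and the right side odd, so both vanish.
  have e₂ := h2 z (-ζ) j
  have e : Q.form z (-ζ) = - Q.form z ζ := by
    ext j
    simp [form_apply]
  simp only [e, mulVec_neg, star_neg, map_neg, LinearMap.neg_apply, neg_neg] at e₂
  linear_combination (e₁ + e₂) / 2

/-- The last condition in `hcore` records that the formula for `f(z, w) - f(0, w)` has a solution,
with `b` a multiple of it. Once `T = 0`, first `f(0, w)` vanishes, then `f` because the form has no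
kernel, and also `g`. -/
theorem gradedPart_three_eq_bot (hQ : Q.Nondegenerate)
    (hcore : ∀ T : (Fin n → ℂ) →ₗ[ℂ] (Fin k → ℂ) →ₗ[ℂ] (Fin k → ℂ) →ₗ[ℂ] ℂ,
      (∀ ξ p q, T ξ p q = T ξ q p) →
      (∀ α z η, T (Q.matrixMap α *ᵥ z) (evalVec Q.matrixMap z η) (evalVec Q.matrixMap z η) = 0) →
      (∀ w z, ∃ b, ∀ α η, (Q.matrixMap α *ᵥ b) ⬝ᵥ η =
        T (Q.matrixMap α *ᵥ z) w (evalVec Q.matrixMap z η)) → T = 0) :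
    Q.gradedPart 3 = ⊥ := by
  rw [eq_bot_iff]
  rintro X ⟨⟨F, -, hF, hFX⟩, f, g, hf, hg, hX⟩
  have hFe : F =ᶠ[𝓝 0] polyField f g := Germ.coe_eq.1 (hFX.trans hX.symm)
  have htan : ∀ᶠ p in 𝓝 (0 : Ambient n k), p ∈ Q.carrier → Q.IsTangentAt p (polyField f g p) := by
    filter_upwards [hF, hFe] with p h₁ h₂
    rwa [← h₂]
  obtain ⟨T, hsymm, h0, hG, h1, h2⟩ := exists_trilinear (Q := Q) hf hg fun z w hp j =>
    re_eq_zero_of_eventually_tangent hf hg htan hp j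
  have hsum : ∀ (α : Fin k → ℂ) z p q, T (Q.matrixMap α *ᵥ z) p q =
      ∑ j, α j * T (Q.H j *ᵥ z) p q := by
    intro α z p q
    rw [matrixMap_apply, sum_mulVec]
    simp [smul_mulVec, LinearMap.sum_apply]
  have hT : T = 0 := by
    refine hcore T hsymm (fun α z η => ?_) fun w z => ?_
    · rw [hsum, evalVec_matrixMap]
      exact Finset.sum_eq_zero fun j _ => by rw [h2, mul_zero]
    · refine ⟨(4 * Complex.I)⁻¹ • ((polyField f g (z, w)).1 - (polyField f g (0, w)).1),
        fun α η => ?_⟩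
      rw [hsum, ← dotProduct_evalVec, evalVec_matrixMap, evalVec_matrixMap]
      refine Finset.sum_congr rfl fun j _ => ?_
      rw [form_smul_left, h1, inv_mul_cancel_left₀ (by simp)]
  subst hT
  have hF0 : ∀ w, (polyField f g ((0 : Fin n → ℂ), w)).1 = 0 := by
    intro w
    have : star (polyField f g ((0 : Fin n → ℂ), star (star w))).1 = 0 :=
      dotProduct_eq_zero _ fun ξ => by rw [dotProduct_comm, h0]; rfl
    simpa using this
  have hzero : polyField f g = 0 := by
    funext ⟨z, w⟩
    refine Prod.ext ?_ ?_
    · refine hQ.1 _ fun ζ => ?_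
      ext j
      have := h1 z ζ w j
      rw [hF0, sub_zero] at this
      rw [this]
      simp
    · ext j
      simpa using hG z w j
  rw [Submodule.mem_bot, ← hX, hzero]
  rfl

end
theorem surjective_matrixMap {Q : Quadric 2 4} (hQ : Q.Nondegenerate) :
    Function.Surjective Q.matrixMap := by
  refine (LinearMap.injective_iff_surjective_of_finrank_eq_finrank (by
    simp [Module.finrank_matrix])).1 ?_
  rw [injective_iff_map_eq_zero]
  exact hQ.isNondegenerateStarSpace.injective

end Quadric

end CRQuadric

theorem mainTheorem3 :
    (∀ Q : CRQuadric.Quadric 3 3, ¬ Q.IsExceptional) ∧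
    (∀ n : ℕ, 1 ≤ n → n ≤ 3 → ∀ Q : CRQuadric.Quadric n 4, ¬ Q.IsExceptional) := by
  refine ⟨fun Q ⟨hQ, hne⟩ => hne ?_, fun n h1 h3 Q ⟨hQ, hne⟩ => ?_⟩
  · exact CRQuadric.Quadric.gradedPart_three_eq_bot hQ fun T hsymm hT _ =>
      hQ.isNondegenerateStarSpace.eq_zero_of_three hsymm hT (Or.inl rfl)
  · obtain rfl | rfl | rfl : n = 1 ∨ n = 2 ∨ n = 3 := by omega
    -- Nondegeneracy would embed a four-dimensional space into the 1 × 1 matrices.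
    · have hle := LinearMap.finrank_le_finrank_of_injective (f := Q.matrixMap)
        ((injective_iff_map_eq_zero _).2 hQ.isNondegenerateStarSpace.injective)
      simp [Module.finrank_matrix] at hle
    · exact hne <| CRQuadric.Quadric.gradedPart_three_eq_bot hQ fun T hsymm _ hT =>
        hQ.isNondegenerateStarSpace.eq_zero_of_two
          (CRQuadric.Quadric.surjective_matrixMap hQ) hsymm hT
    · exact hne <| CRQuadric.Quadric.gradedPart_three_eq_bot hQ fun T hsymm hT _ =>
        hQ.isNondegenerateStarSpace.eq_zero_of_three hsymm hT (Or.inr rfl)
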